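/- Let $n\ge 1$, $d=2^n$, and let $c_1,\dots,c_{2n}$ be the Majorana operators on $n$ qubits, $c_{2j-1}=Z^{\otimes (j-1)}\otimes X\otimes \mathbb 1^{\otimes(n-j)}$ and $c_{2j}=Z^{\otimes (j-1)}\otimes Y\otimes \mathbb 1^{\otimes(n-j)}$. For $0\le\kappa\le 2n$ let $\mathcal B_\kappa$ be the complex span of the products of $\kappa$ distinct Majorana operators, and for an operator $M$ let $M_\kappa=\sum_j \mathrm{Tr}[B_jM]B_j$ be its orthogonal projection onto $\mathcal B_\kappa$, where $\{B_j\}$ is a Hermitian basis of $\mathcal B_\kappa$ that is orthonormal for the Hilbert--Schmidt inner product. With $P=Z^{\otimes n}$ put $$\mathcal P_\kappa(M)=\mathrm{Tr}[M_\kappa^\dagger M_\kappa],\qquad \mathcal C_\kappa(M)=i^{\,\kappa \bmod 2}\,\mathrm{Tr}[P M_\kappa^\dagger M_{2n-\kappa}].$$ Let $\mathcal G=\{Z_i\}_{i=1}^n\cup\{X_iX_{i+1}\}_{i=1}^{n-1}$, let $\mathfrak g$ be the real Lie algebra generated by $i\mathcal G$, and let $G=e^{\mathfrak g}$, a compact group.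 Let $U(\vec\theta)=\prod_{l=1}^L e^{-i\theta_lH_l}$ with $H_l\in\mathcal G$ be a parametrized circuit with random parameters $\vec\theta\in\mathbb R^L$ that forms a $2$-design over $G$, that is, for $t\le 2$ and every operator $A$ the average $\mathbb E_{\vec\theta}[U(\vec\theta)^{\otimes t}A\,U^\dagger(\vec\theta)^{\otimes t}]$ equals $\int_G U^{\otimes t}A\,(U^\dagger)^{\otimes t}\,dU$ with the normalized Haar measure of $G$. Let $\rho$ be an $n$-qubit state, let $O$ be a Hermitian operator, and let $\ell_{\vec\theta}(\rho,O)=\mathrm{Tr}[U(\vec\theta)\rho U^\dagger(\vec\theta)O]$ and $\mathrm{Var}_{\vec\theta}[\ell_{\vec\theta}(\rho,O)]=\mathbb E_{\vec\theta}[\ell_{\vec\theta}(\rho,O)^2]-\mathbb E_{\vec\theta}[\ell_{\vec\theta}(\rho,O)]^2$. If $O\in\mathcal B_\kappa\oplus\mathcal B_{\kappa'}$ with $\kappa\ne\kappa'$, $1\le\kappa,\kappa'\le 2n-1$ and $\kappa,\kappa'\neq n$, then $$\mathrm{Var}_{\vec\theta}[\ell_{\vec\theta}(\rho,O)]=\frac{\mathcal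 P_\kappa(\rho)\mathcal P_\kappa(O)}{\dim\mathcal B_\kappa}+\frac{\mathcal P_{\kappa'}(\rho)\mathcal P_{\kappa'}(O)}{\dim\mathcal B_{\kappa'}}+2\,\delta_{\kappa+\kappa',2n}\,\frac{\mathcal C_\kappa(\rho)\mathcal C_\kappa(O)}{\dim\mathcal B_\kappa},$$ where $\dim\mathcal B_\kappa=\binom{2n}{\kappa}$ and $\dim\mathcal B_{\kappa'}=\binom{2n}{\kappa'}$. -/

import Mathlib

open scoped Matrix ComplexOrder

noncomputable section

namespace Matchgate

attribute [local instance] LieRing.ofAssociativeRing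

/-- Labels of the computational basis of `n` qubits. -/
abbrev Qubits (n : ℕ) : Type := Fin n → Fin 2

/-- Linear operators on the `n`-qubit space `(ℂ²)^{⊗ n}`, as matrices in the computational basis. -/
abbrev Op (n : ℕ) : Type := Matrix (Qubits n) (Qubits n) ℂ

/-- The Pauli matrix `X`. -/
def pauliX : Matrix (Fin 2) (Fin 2) ℂ := !![0, 1; 1, 0]

/-- The Pauli matrix `Y`. -/
def pauliY : Matrix (Fin 2) (Fin 2) ℂ := !![0, -Complex.I; Complex.I, 0]

/-- The Pauli matrix `Z`. -/
def pauliZ : Matrix (Fin 2) (Fin 2) ℂ := !![1, 0; 0, -1]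

/-- The tensor product `A₀ ⊗ A₁ ⊗ ⋯ ⊗ A_{n-1}` of one-qubit operators. -/
def tensor {n : ℕ} (A : Fin n → Matrix (Fin 2) (Fin 2) ℂ) : Op n :=
  Matrix.of fun x y => ∏ i, A i (x i) (y i)

/-- The generators `Z_i` (all `i`) and `X_i X_{i+1}` (neighbouring qubits on the open line). -/
def generators (n : ℕ) : Set (Op n) :=
  {H | (∃ i : Fin n, H = tensor fun k => if k = i then pauliZ else 1) ∨
    (∃ i j : Fin n, (j : ℕ) = i + 1 ∧
      H = tensor fun k => if k = i ∨ k = j then pauliX else 1)}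

/-- The dynamical Lie algebra: the real Lie algebra (for the commutator) generated by
`i H`, with `H` a generator. -/
def dla (n : ℕ) : LieSubalgebra ℝ (Op n) :=
  LieSubalgebra.lieSpan ℝ (Op n) {X | ∃ H ∈ generators n, X = Complex.I • H}

/-- The Lie group `G = e^𝔤` of the circuit, as the closed subgroup of the unitary group generated
by the exponentials of the elements of the dynamical Lie algebra `𝔤`. (The set `e^𝔤` is a compact
connected group, so that passing to the closed subgroup adds no element.) -/
def matchgateGroup (n : ℕ) : Subgroup (Matrix.unitaryGroup (Qubits n) ℂ) :=
  (Subgroup.closure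
    {u : Matrix.unitaryGroup (Qubits n) ℂ |
      ∃ X ∈ dla n, (u : Op n) = NormedSpace.exp X}).topologicalClosure

instance unitaryGroup_compactSpace (n : ℕ) :
    CompactSpace (Matrix.unitaryGroup (Qubits n) ℂ) := by
  refine isCompact_iff_compactSpace.mp ?_
  have hclosed : IsClosed (Matrix.unitaryGroup (Qubits n) ℂ : Set (Op n)) := by
    have h : (Matrix.unitaryGroup (Qubits n) ℂ : Set (Op n)) =
        {A : Op n | star A * A = 1} ∩ {A : Op n | A * star A = 1} := by
      ext A
      exact Unitary.mem_iff
    rw [h]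
    exact (isClosed_eq (by fun_prop) (by fun_prop)).inter
      (isClosed_eq (by fun_prop) (by fun_prop))
  have hK : IsCompact {A : Op n | ∀ x, A x ∈ {v : Qubits n → ℂ | ∀ y,
      v y ∈ Metric.closedBall (0 : ℂ) 1}} :=
    isCompact_pi_infinite fun _ => isCompact_pi_infinite fun _ => isCompact_closedBall 0 1
  refine hK.of_isClosed_subset hclosed ?_
  intro A hA x y
  simpa using entry_norm_bound_of_unitary hA x y

instance group_compactSpace (n : ℕ) : CompactSpace (matchgateGroup n) :=
  isCompact_iff_compactSpace.mp (Subgroup.isClosed_topologicalClosure _).isCompact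

instance group_measurableSpace (n : ℕ) : MeasurableSpace (matchgateGroup n) := borel _

instance group_borelSpace (n : ℕ) : BorelSpace (matchgateGroup n) := ⟨rfl⟩

/-- The normalized Haar measure on `G`. -/
def haar (n : ℕ) : MeasureTheory.Measure (matchgateGroup n) :=
  MeasureTheory.Measure.haarMeasure (⊤ : TopologicalSpace.PositiveCompacts (matchgateGroup n))

/-- The parametrized circuit `U(θ) = ∏_l e^{-i θ_l H_l}` with `L` gates. -/
def circuit {n L : ℕ} (H : Fin L → Op n) (θ : Fin L → ℝ) : Op n :=
  (List.ofFn fun l => NormedSpace.exp ((-Complex.I * (θ l : ℂ)) • H l)).prod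

/-- The tensor power `A^{⊗ t}`. -/
def tensorPow {ι : Type*} (t : ℕ) (A : Matrix ι ι ℂ) :
    Matrix (Fin t → ι) (Fin t → ι) ℂ :=
  Matrix.of fun x y => ∏ k, A (x k) (y k)

/-- The random operator `U`, with its randomness distributed according to `μ`, forms a
`2`-design over `G`: for `t ≤ 2` and every operator `A` on the `t`-fold tensor power, the averages
of `U^{⊗ t} A (U^†)^{⊗ t}` over `μ` and over the Haar measure of `G` agree, entry by entry. -/
def IsTwoDesign {n : ℕ} {Θ : Type*} [MeasurableSpace Θ] (μ : MeasureTheory.Measure Θ)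
    (U : Θ → Op n) : Prop :=
  ∀ t : ℕ, t ≤ 2 → ∀ A : Matrix (Fin t → Qubits n) (Fin t → Qubits n) ℂ,
    ∀ x y : Fin t → Qubits n,
      ∫ θ, (tensorPow t (U θ) * A * tensorPow t ((U θ)ᴴ)) x y ∂μ =
        ∫ g : matchgateGroup n, (tensorPow t ((g : Matrix.unitaryGroup (Qubits n) ℂ) : Op n) * A *
          tensorPow t (((g : Matrix.unitaryGroup (Qubits n) ℂ) : Op n)ᴴ)) x y ∂(haar n)

/-- The loss `Tr[U ρ U^† O]`. -/
def loss {n : ℕ} (ρ O U : Op n) : ℂ := (U * ρ * Uᴴ * O).trace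

/-- The variance `𝔼[ℓ²] - 𝔼[ℓ]²` of the loss of the random operator `U`. -/
def lossVariance {n : ℕ} {Θ : Type*} [MeasurableSpace Θ] (μ : MeasureTheory.Measure Θ)
    (ρ O : Op n) (U : Θ → Op n) : ℂ :=
  (∫ θ, loss ρ O (U θ) ^ 2 ∂μ) - (∫ θ, loss ρ O (U θ) ∂μ) ^ 2

/-- The Majorana operators `c_μ`, indexed from `0`: the indices `2j` and `2j+1` give
`Z ⋯ Z X 1 ⋯ 1` and `Z ⋯ Z Y 1 ⋯ 1`, with `X` or `Y` on the qubit `j`. -/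
def majorana {n : ℕ} (m : Fin (2 * n)) : Op n :=
  tensor fun k =>
    if (k : ℕ) < (m : ℕ) / 2 then pauliZ
    else if (k : ℕ) = (m : ℕ) / 2 then (if (m : ℕ) % 2 = 0 then pauliX else pauliY)
    else 1

/-- The product `c^s` of the distinct Majorana operators with index in `s`, in increasing order. -/
def majoranaProd {n : ℕ} (s : Finset (Fin (2 * n))) : Op n :=
  ((s.sort (· ≤ ·)).map majorana).prod

/-- The module `𝓑_κ`: the complex span of the products of `κ` distinct Majorana operators. -/
def majoranaModule (n κ : ℕ) : Submodule ℂ (Op n) :=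
  Submodule.span ℂ {M | ∃ s : Finset (Fin (2 * n)), s.card = κ ∧ M = majoranaProd s}

/-- The Hermitian, Hilbert--Schmidt normalized multiples `i^{⌊κ/2⌋} c^s / √(2^n)`, `κ = |s|`,
of the Majorana products. -/
def basisOp {n : ℕ} (s : Finset (Fin (2 * n))) : Op n :=
  (Complex.I ^ (s.card / 2) / ((Real.sqrt (2 ^ n) : ℝ) : ℂ)) • majoranaProd s

/-- The orthogonal projection `M_κ = ∑_j Tr[B_j M] B_j` of `M` onto `𝓑_κ`. -/
def component {n : ℕ} (κ : ℕ) (M : Op n) : Op n :=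
  ∑ s ∈ Finset.powersetCard κ (Finset.univ : Finset (Fin (2 * n))),
    (basisOp s * M).trace • basisOp s

/-- The fermionic parity operator `P = Z^{⊗ n}`. -/
def parity (n : ℕ) : Op n := tensor fun _ => pauliZ

/-- The form `⟨M₁, M₂⟩_Γ = Tr[Γ M₁^† M₂]`. -/
def form {n : ℕ} (Γ M₁ M₂ : Op n) : ℂ := (Γ * M₁ᴴ * M₂).trace

/-- The `κ`-purity `⟨M_κ, M_κ⟩_1`. -/
def purity {n : ℕ} (κ : ℕ) (M : Op n) : ℂ := form 1 (component κ M) (component κ M)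

/-- The `κ`-coherence `i^{κ mod 2} ⟨M_κ, M_{2n-κ}⟩_P`, for `κ ≤ 2n`. -/
def coherence {n : ℕ} (κ : ℕ) (M : Op n) : ℂ :=
  Complex.I ^ (κ % 2) * form (parity n) (component κ M) (component (2 * n - κ) M)

end Matchgate

end

open scoped Matrix ComplexOrder

noncomputable section

namespace Matchgate

theorem tensor_mul {n : ℕ} (A B : Fin n → Matrix (Fin 2) (Fin 2) ℂ) :
    tensor A * tensor B = tensor fun k => A k * B k := by
  ext x y
  simp only [tensor, Matrix.mul_apply, Matrix.of_apply, ← Finset.prod_mul_distrib]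
  rw [Finset.prod_univ_sum, Fintype.piFinset_univ]

theorem tensor_one {n : ℕ} : tensor (fun _ : Fin n => 1) = (1 : Op n) := by
  ext x y
  simp only [tensor, Matrix.of_apply, Matrix.one_apply, Finset.prod_ite_zero, Finset.prod_const_one,
    funext_iff, Finset.mem_univ, true_implies]

theorem tensor_smul {n : ℕ} (a : Fin n → ℂ) (A : Fin n → Matrix (Fin 2) (Fin 2) ℂ) :
    tensor (fun k => a k • A k) = (∏ k, a k) • tensor A := by
  ext x y
  simp [tensor, Finset.prod_mul_distrib]

theorem tensor_conjTranspose {n : ℕ} (A : Fin n → Matrix (Fin 2) (Fin 2) ℂ) :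
    (tensor A)ᴴ = tensor fun k => (A k)ᴴ := by
  ext x y
  simp [tensor, Matrix.conjTranspose_apply]

theorem tensor_eq_smul {n : ℕ} {A B : Fin n → Matrix (Fin 2) (Fin 2) ℂ} (j : Fin n) (c : ℂ)
    (h : ∀ k, A k = (if k = j then c else 1) • B k) : tensor A = c • tensor B := by
  rw [funext h, tensor_smul]
  simp

theorem pauliX_mul_self : pauliX * pauliX = 1 := by
  ext i j; fin_cases i <;> fin_cases j <;> simp [pauliX]

theorem pauliY_mul_self : pauliY * pauliY = 1 := by
  ext i j; fin_cases i <;> fin_cases j <;> simp [pauliY]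

theorem pauliZ_mul_self : pauliZ * pauliZ = 1 := by
  ext i j; fin_cases i <;> fin_cases j <;> simp [pauliZ]

theorem pauliX_conjTranspose : pauliXᴴ = pauliX := by
  ext i j; fin_cases i <;> fin_cases j <;> simp [pauliX]

theorem pauliY_conjTranspose : pauliYᴴ = pauliY := by
  ext i j; fin_cases i <;> fin_cases j <;> simp [pauliY]

theorem pauliZ_conjTranspose : pauliZᴴ = pauliZ := by
  ext i j; fin_cases i <;> fin_cases j <;> simp [pauliZ]

theorem pauliX_mul_pauliY : pauliX * pauliY = Complex.I • pauliZ := by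
  ext i j; fin_cases i <;> fin_cases j <;> simp [pauliX, pauliY, pauliZ]

theorem pauliY_mul_pauliZ : pauliY * pauliZ = Complex.I • pauliX := by
  ext i j; fin_cases i <;> fin_cases j <;> simp [pauliX, pauliY, pauliZ]

theorem pauliX_mul_pauliY_eq_neg : pauliX * pauliY = -(pauliY * pauliX) := by
  ext i j; fin_cases i <;> fin_cases j <;> simp [pauliX, pauliY]

theorem pauliX_mul_pauliZ_eq_neg : pauliX * pauliZ = -(pauliZ * pauliX) := by
  ext i j; fin_cases i <;> fin_cases j <;> simp [pauliX, pauliZ]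

theorem pauliY_mul_pauliZ_eq_neg : pauliY * pauliZ = -(pauliZ * pauliY) := by
  ext i j; fin_cases i <;> fin_cases j <;> simp [pauliY, pauliZ]

section Majorana

variable {n : ℕ}

theorem majorana_mul_self (m : Fin (2 * n)) : (majorana m : Op n) * majorana m = 1 := by
  rw [majorana, tensor_mul, ← tensor_one]
  congr 1; funext k
  split_ifs <;> simp [pauliX_mul_self, pauliY_mul_self, pauliZ_mul_self]

theorem majorana_conjTranspose (m : Fin (2 * n)) : (majorana m : Op n)ᴴ = majorana m := by
  rw [majorana, tensor_conjTranspose]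
  congr 1; funext k
  split_ifs <;> simp [pauliX_conjTranspose, pauliY_conjTranspose, pauliZ_conjTranspose]

theorem majorana_mul_comm_of_lt {a b : Fin (2 * n)} (h : a < b) :
    (majorana a : Op n) * majorana b = -(majorana b * majorana a) := by
  have hab : (a : ℕ) < b := h
  have ha : (a : ℕ) / 2 < n := by omega
  rw [majorana, majorana, tensor_mul, tensor_mul, ← neg_one_smul ℂ]
  refine tensor_eq_smul ⟨(a : ℕ) / 2, ha⟩ (-1) fun k => ?_
  rcases lt_trichotomy (k : ℕ) ((a : ℕ) / 2) with hk | hk | hk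
  · have h1 : (k : ℕ) < (b : ℕ) / 2 := by omega
    have h2 : k ≠ ⟨(a : ℕ) / 2, ha⟩ := by rw [Ne, Fin.ext_iff]; exact hk.ne
    simp [hk, h1, h2]
  · have h2 : k = ⟨(a : ℕ) / 2, ha⟩ := Fin.ext hk
    rw [if_pos h2, if_neg (by omega), if_pos hk, neg_one_smul]
    by_cases hb : (k : ℕ) < (b : ℕ) / 2
    · rw [if_pos hb]
      split_ifs
      · exact pauliX_mul_pauliZ_eq_neg
      · exact pauliY_mul_pauliZ_eq_neg
    · have e1 : (a : ℕ) % 2 = 0 := by omega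
      have e2 : (b : ℕ) % 2 ≠ 0 := by omega
      have e3 : (k : ℕ) = (b : ℕ) / 2 := by omega
      rw [if_neg hb, if_pos e1, if_pos e3, if_neg e2]
      exact pauliX_mul_pauliY_eq_neg
  · have h2 : k ≠ ⟨(a : ℕ) / 2, ha⟩ := by rw [Ne, Fin.ext_iff]; exact hk.ne'
    rw [if_neg h2, if_neg (by omega), if_neg (by omega)]
    simp

theorem majorana_mul_comm {a b : Fin (2 * n)} (h : a ≠ b) :
    (majorana a : Op n) * majorana b = -(majorana b * majorana a) := by
  rcases lt_or_gt_of_ne h with h | h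
  · exact majorana_mul_comm_of_lt h
  · rw [majorana_mul_comm_of_lt h, neg_neg]

theorem majorana_even_mul_odd (j : Fin n) :
    (majorana ⟨2 * j, by omega⟩ : Op n) * majorana ⟨2 * j + 1, by omega⟩ =
      Complex.I • tensor fun k => if k = j then pauliZ else 1 := by
  rw [majorana, majorana, tensor_mul]
  refine tensor_eq_smul j _ fun k => ?_
  have e1 : (2 * (j : ℕ)) / 2 = j := by omega
  have e2 : (2 * (j : ℕ) + 1) / 2 = j := by omega
  have e3 : (2 * (j : ℕ)) % 2 = 0 := by omega
  have e4 : (2 * (j : ℕ) + 1) % 2 = 1 := by omega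
  simp only [e1, e2, e3, e4, Fin.ext_iff]
  rcases lt_trichotomy (k : ℕ) (j : ℕ) with hk | hk | hk
  · simp [hk, hk.ne, pauliZ_mul_self]
  · simp [hk, pauliX_mul_pauliY]
  · simp [hk.ne', hk.not_gt]

theorem majorana_odd_mul_even (i j : Fin n) (h : (j : ℕ) = i + 1) :
    (majorana ⟨2 * i + 1, by omega⟩ : Op n) * majorana ⟨2 * i + 2, by omega⟩ =
      Complex.I • tensor fun k => if k = i ∨ k = j then pauliX else 1 := by
  rw [majorana, majorana, tensor_mul]
  refine tensor_eq_smul i _ fun k => ?_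
  have e1 : (2 * (i : ℕ) + 1) / 2 = i := by omega
  have e2 : (2 * (i : ℕ) + 2) / 2 = i + 1 := by omega
  have e3 : (2 * (i : ℕ) + 1) % 2 = 1 := by omega
  have e4 : (2 * (i : ℕ) + 2) % 2 = 0 := by omega
  simp only [e1, e2, e3, e4, Fin.ext_iff, h]
  rcases lt_trichotomy (k : ℕ) (i : ℕ) with hk | hk | hk
  · have : (k : ℕ) < i + 1 := by omega
    have h3 : (k : ℕ) ≠ i + 1 := by omega
    simp [hk, hk.ne, this, h3, pauliZ_mul_self]
  · simp [hk, pauliY_mul_pauliZ]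
  · have h3 : ¬ (k : ℕ) < i + 1 := by omega
    simp [hk.ne', hk.not_gt, h3]

theorem parity_mul_majorana (m : Fin (2 * n)) :
    parity n * majorana m = -(majorana m * parity n) := by
  have ha : (m : ℕ) / 2 < n := by omega
  rw [parity, majorana, tensor_mul, tensor_mul, ← neg_one_smul ℂ]
  refine tensor_eq_smul ⟨(m : ℕ) / 2, ha⟩ (-1) fun k => ?_
  simp only [Fin.ext_iff]
  rcases lt_trichotomy (k : ℕ) ((m : ℕ) / 2) with hk | hk | hk
  · simp [hk, hk.ne]
  · simp only [hk, lt_irrefl, if_true, if_false, neg_one_smul]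
    split_ifs
    · rw [pauliX_mul_pauliZ_eq_neg, neg_neg]
    · rw [pauliY_mul_pauliZ_eq_neg, neg_neg]
  · simp [hk.ne', hk.not_gt]

theorem parity_mul_self : parity n * parity n = 1 := by
  rw [parity, tensor_mul, ← tensor_one]
  simp only [pauliZ_mul_self]

theorem prod_map_tensor_pauliZ (l : List (Fin n)) (hl : l.Nodup) :
    (l.map fun j => tensor fun k => if k = j then pauliZ else 1).prod =
      tensor fun k => if k ∈ l then pauliZ else 1 := by
  induction l with
  | nil => simp [tensor_one]
  | cons a l ih =>
    rw [List.nodup_cons] at hl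
    rw [List.map_cons, List.prod_cons, ih hl.2, tensor_mul]
    congr 1; funext k
    by_cases hk : k = a
    · subst hk; simp [hl.1]
    · simp [hk]

theorem parity_eq_prod :
    parity n = ((List.finRange n).map fun j => tensor fun k => if k = j then pauliZ else 1).prod := by
  rw [prod_map_tensor_pauliZ _ (List.nodup_finRange n)]
  simp [parity]

end Majorana

end Matchgate

namespace Matchgate

variable {n : ℕ}

/-- Equality of two operators up to a sign. -/
def EqUpToSign (A B : Op n) : Prop := A = B ∨ A = -B

namespace EqUpToSign

theorem refl (A : Op n) : EqUpToSign A A := Or.inl rfl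

theorem symm {A B : Op n} (h : EqUpToSign A B) : EqUpToSign B A := by
  rcases h with rfl | rfl
  · exact Or.inl rfl
  · exact Or.inr (neg_neg B).symm

theorem trans {A B C : Op n} (h : EqUpToSign A B) (h' : EqUpToSign B C) : EqUpToSign A C := by
  rcases h with rfl | rfl
  · exact h'
  · rcases h' with rfl | rfl
    · exact Or.inr rfl
    · exact Or.inl (neg_neg C)

theorem mul_left {A B : Op n} (C : Op n) (h : EqUpToSign A B) : EqUpToSign (C * A) (C * B) := by
  rcases h with rfl | rfl
  · exact Or.inl rfl
  · exact Or.inr (Matrix.mul_neg _ _)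

theorem smul {A B : Op n} (c : ℂ) (h : EqUpToSign A B) : EqUpToSign (c • A) (c • B) := by
  rcases h with rfl | rfl
  · exact Or.inl rfl
  · exact Or.inr (smul_neg _ _)

theorem mem {A B : Op n} (h : EqUpToSign A B) {S : Submodule ℂ (Op n)} (hB : B ∈ S) : A ∈ S := by
  rcases h with rfl | rfl
  · exact hB
  · exact S.neg_mem hB

end EqUpToSign

theorem eqUpToSign_prod_of_perm {l l' : List (Fin (2 * n))} (h : l.Perm l') :
    EqUpToSign (l.map majorana).prod ((l'.map majorana).prod : Op n) := by
  induction h with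
  | nil => exact .refl _
  | cons a _ ih => simpa using ih.mul_left _
  | swap a b l =>
    by_cases hab : a = b
    · subst hab; exact .refl _
    · refine Or.inr ?_
      simp only [List.map_cons, List.prod_cons, ← mul_assoc]
      rw [majorana_mul_comm (Ne.symm hab), neg_mul]
  | trans _ _ h1 h2 => exact h1.trans h2

theorem eqUpToSign_majoranaProd {l : List (Fin (2 * n))} (hl : l.Nodup)
    {s : Finset (Fin (2 * n))} (h : ∀ a, a ∈ l ↔ a ∈ s) :
    EqUpToSign (l.map majorana).prod (majoranaProd s : Op n) := by
  refine eqUpToSign_prod_of_perm ?_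
  rw [List.perm_ext_iff_of_nodup hl (Finset.sort_nodup _ _)]
  simpa using h

theorem majorana_mul_majoranaProd (m : Fin (2 * n)) (s : Finset (Fin (2 * n))) :
    EqUpToSign (majorana m * majoranaProd s : Op n) (majoranaProd (symmDiff {m} s)) := by
  by_cases hm : m ∈ s
  · have h1 : EqUpToSign (majorana m * majoranaProd (symmDiff {m} s) : Op n) (majoranaProd s) := by
      have := eqUpToSign_majoranaProd (n := n) (l := m :: (symmDiff {m} s).sort (· ≤ ·)) (s := s)
        (by simp [Finset.sort_nodup, Finset.mem_symmDiff, hm])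
        (by
          intro a
          by_cases ha : a = m
          · subst ha; simp [hm]
          · simp [Finset.mem_symmDiff, ha])
      simpa [majoranaProd] using this
    have h2 := (h1.mul_left (majorana m)).symm
    rwa [← mul_assoc, majorana_mul_self, one_mul] at h2
  · have := eqUpToSign_majoranaProd (n := n) (l := m :: s.sort (· ≤ ·)) (s := symmDiff {m} s)
      (by simp [Finset.sort_nodup, hm])
      (by
        intro a
        by_cases ha : a = m
        · subst ha; simp [Finset.mem_symmDiff, hm]
        · simp [Finset.mem_symmDiff, ha])
    simpa [majoranaProd] using this

theorem majoranaProd_empty : (majoranaProd ∅ : Op n) = 1 := by simp [majoranaProd]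

theorem majoranaProd_mul (s t : Finset (Fin (2 * n))) :
    EqUpToSign (majoranaProd s * majoranaProd t : Op n) (majoranaProd (symmDiff s t)) := by
  induction s using Finset.induction_on with
  | empty =>
    rw [majoranaProd_empty, one_mul, ← Finset.bot_eq_empty, bot_symmDiff]
    exact .refl _
  | insert a s ha ih =>
    have h1 : symmDiff {a} s = insert a s := by
      ext b
      by_cases hb : b = a
      · subst hb; simp [Finset.mem_symmDiff, ha]
      · simp [Finset.mem_symmDiff, hb]
    have h2 := majorana_mul_majoranaProd a s
    rw [h1] at h2
    have h3 : EqUpToSign (majoranaProd (insert a s) * majoranaProd t : Op n)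
        (majorana a * majoranaProd s * majoranaProd t) := by
      rcases h2.symm with h | h
      · exact Or.inl (by rw [h])
      · exact Or.inr (by rw [h, neg_mul])
    refine h3.trans ?_
    rw [mul_assoc, ← h1, symmDiff_assoc]
    exact (ih.mul_left _).trans (majorana_mul_majoranaProd _ _)

theorem majoranaProd_mem (s : Finset (Fin (2 * n))) {κ : ℕ} (hs : s.card = κ) :
    majoranaProd s ∈ majoranaModule n κ := Submodule.subset_span ⟨s, hs, rfl⟩

/-- The parity operator is a multiple of the product of all Majorana operators. -/
theorem parity_eq_smul_majoranaProd :
    ∃ c : ℂ, parity n = c • (majoranaProd Finset.univ : Op n) := by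
  set pr : Fin n → List (Fin (2 * n)) :=
    fun j => [⟨2 * j, by omega⟩, ⟨2 * j + 1, by omega⟩] with hpr
  set l := (List.finRange n).flatMap pr with hl
  have hprod : ∀ L : List (Fin n), ((L.flatMap pr).map majorana).prod =
      Complex.I ^ L.length •
        ((L.map fun j => tensor fun k => if k = j then pauliZ else 1).prod : Op n) := by
    intro L
    induction L with
    | nil => simp
    | cons j L ih =>
      rw [List.flatMap_cons, List.map_append, List.prod_append, ih]
      simp only [hpr, List.map_cons, List.map_nil, List.prod_cons, List.prod_nil, mul_one,
        List.length_cons]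
      rw [majorana_even_mul_odd, smul_mul_smul_comm, pow_succ']
  have hnodup : l.Nodup := by
    rw [hl, List.nodup_flatMap]
    refine ⟨fun j _ => by simp [hpr], (List.nodup_finRange n).imp_of_mem ?_⟩
    intro a b _ _ hab
    have : (a : ℕ) ≠ b := fun h => hab (Fin.ext h)
    simp only [hpr, Function.onFun, List.disjoint_left, List.mem_cons, List.not_mem_nil, or_false,
      Fin.ext_iff]
    intro c hc
    omega
  have hmem : ∀ a, a ∈ l ↔ a ∈ (Finset.univ : Finset (Fin (2 * n))) := by
    intro a
    simp only [hl, hpr, List.mem_flatMap, List.mem_finRange, true_and, Finset.mem_univ, iff_true,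
      List.mem_cons, List.not_mem_nil, or_false, Fin.ext_iff]
    exact ⟨⟨(a : ℕ) / 2, by omega⟩, by simp only; omega⟩
  have h1 := eqUpToSign_majoranaProd hnodup hmem
  rw [hl, hprod, ← parity_eq_prod] at h1
  have hI : (Complex.I ^ (List.finRange n).length) ≠ 0 := pow_ne_zero _ Complex.I_ne_zero
  rcases h1 with h | h
  · exact ⟨_, (inv_smul_eq_iff₀ hI).mpr h.symm |>.symm⟩
  · refine ⟨-(Complex.I ^ (List.finRange n).length)⁻¹, ?_⟩
    rw [neg_smul, ← smul_neg, ← h, inv_smul_smul₀ hI]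

theorem parity_mul_mem {κ : ℕ} {M : Op n} (hM : M ∈ majoranaModule n κ) :
    parity n * M ∈ majoranaModule n (2 * n - κ) := by
  obtain ⟨c, hc⟩ := parity_eq_smul_majoranaProd (n := n)
  induction hM using Submodule.span_induction with
  | mem x hx =>
    obtain ⟨s, hs, rfl⟩ := hx
    rw [hc, smul_mul_assoc]
    refine Submodule.smul_mem _ _ ((majoranaProd_mul _ _).mem (majoranaProd_mem _ ?_))
    rw [← Finset.top_eq_univ, top_symmDiff, hnot_eq_compl, Finset.card_compl, Fintype.card_fin, hs]
  | zero => simp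
  | add x y _ _ hx hy => rw [mul_add]; exact add_mem hx hy
  | smul a x _ hx => rw [mul_smul_comm]; exact Submodule.smul_mem _ _ hx

/-- An operator that commutes or anticommutes with each Majorana operator does so with products. -/
theorem mul_prod_map_majorana {A : Op n} {τ : Fin (2 * n) → ℂ}
    (h : ∀ m, A * majorana m = τ m • (majorana m * A)) (l : List (Fin (2 * n))) :
    A * (l.map majorana).prod = (l.map τ).prod • ((l.map majorana).prod * A) := by
  induction l with
  | nil => simp
  | cons a l ih =>
    simp only [List.map_cons, List.prod_cons]
    rw [← mul_assoc, h, smul_mul_assoc, mul_assoc, ih, mul_smul_comm, smul_smul, mul_assoc]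

theorem mul_majoranaProd {A : Op n} {τ : Fin (2 * n) → ℂ}
    (h : ∀ m, A * majorana m = τ m • (majorana m * A)) (s : Finset (Fin (2 * n))) :
    A * majoranaProd s = (∏ m ∈ s, τ m) • (majoranaProd s * A) := by
  rw [majoranaProd, mul_prod_map_majorana h, Finset.prod_eq_multiset_prod,
    ← Finset.sort_eq s (· ≤ ·), Multiset.map_coe, Multiset.prod_coe]

theorem parity_mul_majoranaProd (s : Finset (Fin (2 * n))) :
    parity n * majoranaProd s = (-1 : ℂ) ^ s.card • (majoranaProd s * parity n) := by
  rw [mul_majoranaProd (τ := fun _ => -1) fun m => by rw [parity_mul_majorana, neg_one_smul]]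
  simp

theorem parity_mul_eq {κ : ℕ} {M : Op n} (hM : M ∈ majoranaModule n κ) :
    parity n * M = (-1 : ℂ) ^ κ • (M * parity n) := by
  induction hM using Submodule.span_induction with
  | mem x hx =>
    obtain ⟨s, hs, rfl⟩ := hx
    rw [parity_mul_majoranaProd, hs]
  | zero => simp
  | add x y _ _ hx hy => rw [mul_add, hx, hy, add_mul, smul_add]
  | smul a x _ hx => rw [mul_smul_comm, hx, smul_mul_assoc, smul_comm]

theorem majorana_mul_majoranaProd_comm (m : Fin (2 * n)) (s : Finset (Fin (2 * n))) :
    majorana m * majoranaProd s =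
      (∏ a ∈ s, if a = m then (1 : ℂ) else -1) • (majoranaProd s * majorana m) :=
  mul_majoranaProd (fun a => by
    by_cases h : a = m
    · simp [h]
    · rw [if_neg h, majorana_mul_comm (Ne.symm h), neg_one_smul]) s

/-- Products of two different Majorana operators commute or anticommute with products. -/
theorem pair_mul_majorana {a b : Fin (2 * n)} (hab : a ≠ b) (m : Fin (2 * n)) :
    majorana a * majorana b * majorana m =
      (if m = a ∨ m = b then (-1 : ℂ) else 1) • ((majorana m * (majorana a * majorana b)) : Op n) := by
  by_cases ha : m = a
  · subst ha
    rw [if_pos (Or.inl rfl), mul_assoc, majorana_mul_comm hab.symm, mul_neg, neg_one_smul]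
  · by_cases hb : m = b
    · subst hb
      rw [if_pos (Or.inr rfl), ← mul_assoc, majorana_mul_comm ha, neg_mul, neg_one_smul, neg_neg]
    · rw [if_neg (by tauto), one_smul, mul_assoc, majorana_mul_comm (Ne.symm hb), mul_neg,
        ← mul_assoc, majorana_mul_comm (Ne.symm ha), neg_mul, neg_neg, mul_assoc]

theorem pair_mul_majoranaProd {a b : Fin (2 * n)} (hab : a ≠ b) (s : Finset (Fin (2 * n))) :
    majorana a * majorana b * majoranaProd s =
      ((if a ∈ s then (-1 : ℂ) else 1) * (if b ∈ s then (-1 : ℂ) else 1)) •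
        ((majoranaProd s * (majorana a * majorana b)) : Op n) := by
  rw [mul_majoranaProd (pair_mul_majorana hab)]
  congr 1
  rw [← Finset.prod_ite_eq' s a (fun _ => (-1 : ℂ)), ← Finset.prod_ite_eq' s b (fun _ => (-1 : ℂ)),
    ← Finset.prod_mul_distrib]
  refine Finset.prod_congr rfl fun m _ => ?_
  by_cases ha : m = a
  · subst ha; simp [hab]
  · simp [ha]

theorem trace_eq_zero_of_anticomm {A B : Op n} (hA : A * A = 1) (h : A * B = -(B * A)) :
    B.trace = 0 := by
  have h1 : (A * B * A).trace = B.trace := by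
    rw [Matrix.trace_mul_comm, ← mul_assoc, hA, one_mul]
  rw [h, neg_mul, mul_assoc, hA, mul_one, Matrix.trace_neg] at h1
  exact self_eq_neg.mp h1.symm

theorem trace_majoranaProd {s : Finset (Fin (2 * n))} (hs : s ≠ ∅) :
    (majoranaProd s : Op n).trace = 0 := by
  rcases Nat.even_or_odd s.card with he | ho
  · obtain ⟨m, hm⟩ := Finset.nonempty_iff_ne_empty.mpr hs
    refine trace_eq_zero_of_anticomm (majorana_mul_self m) ?_
    rw [majorana_mul_majoranaProd_comm, ← Finset.mul_prod_erase s _ hm, if_pos rfl, one_mul,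
      Finset.prod_congr rfl fun a ha => if_neg (Finset.ne_of_mem_erase ha), Finset.prod_const,
      Finset.card_erase_of_mem hm, Odd.neg_one_pow, neg_one_smul]
    have : 0 < s.card := Finset.card_pos.mpr ⟨m, hm⟩
    exact Nat.Even.sub_odd this he odd_one
  · refine trace_eq_zero_of_anticomm parity_mul_self ?_
    rw [parity_mul_majoranaProd, ho.neg_one_pow, neg_one_smul]

theorem prod_map_majorana_conjTranspose (l : List (Fin (2 * n))) (hl : l.Nodup) :
    ((l.map majorana).prod : Op n)ᴴ =
      (-1 : ℂ) ^ (l.length * (l.length - 1) / 2) • (l.map majorana).prod := by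
  induction l with
  | nil => simp
  | cons a l ih =>
    rw [List.nodup_cons] at hl
    have hτ : ∀ L : List (Fin (2 * n)), a ∉ L → (majorana a : Op n) * (L.map majorana).prod =
        (-1 : ℂ) ^ L.length • ((L.map majorana).prod * majorana a) := by
      intro L
      induction L with
      | nil => simp
      | cons b L ihL =>
        intro hb
        rw [List.mem_cons, not_or] at hb
        simp only [List.map_cons, List.prod_cons, List.length_cons]
        rw [← mul_assoc, majorana_mul_comm hb.1, neg_mul, mul_assoc, ihL hb.2, mul_smul_comm,
          mul_assoc, pow_succ, mul_neg_one, neg_smul]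
    have h3 : (l.length + 1) * (l.length + 1 - 1) / 2 =
        l.length * (l.length - 1) / 2 + l.length := by
      have := Finset.sum_range_succ (fun i => i) l.length
      rwa [Finset.sum_range_id, Finset.sum_range_id] at this
    simp only [List.map_cons, List.prod_cons, List.length_cons]
    rw [Matrix.conjTranspose_mul, ih hl.2, majorana_conjTranspose, hτ l hl.1, h3, pow_add,
      smul_mul_assoc, smul_smul, mul_assoc, ← pow_add _ l.length, Even.neg_one_pow ⟨_, rfl⟩,
      mul_one]

theorem majoranaProd_conjTranspose (s : Finset (Fin (2 * n))) :
    (majoranaProd s : Op n)ᴴ = (-1 : ℂ) ^ (s.card / 2) • majoranaProd s := by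
  rw [majoranaProd, prod_map_majorana_conjTranspose _ (Finset.sort_nodup _ _), Finset.length_sort]
  congr 1
  obtain ⟨k, hk⟩ | ⟨k, hk⟩ := Nat.even_or_odd s.card
  · rw [hk, show (k + k) * (k + k - 1) = 2 * (k * (k + k - 1)) by ring,
      Nat.mul_div_cancel_left _ two_pos, show (k + k) / 2 = k by omega]
    rcases Nat.eq_zero_or_pos k with rfl | h
    · simp
    · rw [pow_mul', Odd.neg_one_pow ⟨k - 1, by omega⟩]
  · rw [hk, Nat.add_sub_cancel, show (2 * k + 1) * (2 * k) = 2 * (k * (2 * k + 1)) by ring,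
      Nat.mul_div_cancel_left _ two_pos, show (2 * k + 1) / 2 = k by omega, pow_mul',
      Odd.neg_one_pow ⟨k, rfl⟩]

theorem basisOp_conjTranspose (s : Finset (Fin (2 * n))) : (basisOp s : Op n)ᴴ = basisOp s := by
  rw [basisOp, Matrix.conjTranspose_smul, majoranaProd_conjTranspose, smul_smul]
  congr 1
  simp only [star_div₀, star_pow, Complex.star_def, Complex.conj_I, Complex.conj_ofReal]
  rw [div_mul_eq_mul_div, ← mul_pow]
  simp

theorem majoranaProd_mul_conjTranspose (s : Finset (Fin (2 * n))) :
    (majoranaProd s : Op n) * (majoranaProd s)ᴴ = 1 := by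
  have : ∀ l : List (Fin (2 * n)), (l.map majorana).prod * ((l.map majorana).prod : Op n)ᴴ = 1 := by
    intro l
    induction l with
    | nil => simp
    | cons a l ih =>
      rw [List.map_cons, List.prod_cons, Matrix.conjTranspose_mul, mul_assoc,
        ← mul_assoc (l.map majorana).prod, ih, one_mul, majorana_conjTranspose, majorana_mul_self]
  exact this _

theorem trace_basisOp_mul_self (s : Finset (Fin (2 * n))) :
    ((basisOp s : Op n) * basisOp s).trace = 1 := by
  nth_rw 2 [← basisOp_conjTranspose s]
  rw [basisOp, Matrix.conjTranspose_smul, smul_mul_smul_comm,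
    majoranaProd_mul_conjTranspose, Matrix.trace_smul, Matrix.trace_one, smul_eq_mul,
    Complex.star_def, Complex.mul_conj]
  have h2 : (0 : ℝ) ≤ 2 ^ n := by positivity
  have h3 : (2 : ℂ) ^ n ≠ 0 := by positivity
  simp only [map_div₀, map_pow, Complex.normSq_I, one_pow, Complex.normSq_ofReal,
    Real.mul_self_sqrt h2, Fintype.card_pi, Fintype.card_fin, Finset.prod_const, Finset.card_univ]
  push_cast
  field_simp

theorem trace_basisOp_mul {s t : Finset (Fin (2 * n))} (h : s ≠ t) :
    ((basisOp s : Op n) * basisOp t).trace = 0 := by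
  have h0 : (majoranaProd s * majoranaProd t : Op n).trace = 0 := by
    have : (majoranaProd (symmDiff s t) : Op n).trace = 0 :=
      trace_majoranaProd fun h' => h (symmDiff_eq_bot.mp h')
    rcases majoranaProd_mul s t with h' | h' <;> simp [h', this]
  rw [basisOp, basisOp, smul_mul_smul_comm, Matrix.trace_smul, h0, smul_zero]

theorem basisOp_mem {s : Finset (Fin (2 * n))} {κ : ℕ} (hs : s.card = κ) :
    basisOp s ∈ majoranaModule n κ := Submodule.smul_mem _ _ (majoranaProd_mem s hs)

theorem component_mem (κ : ℕ) (M : Op n) : component κ M ∈ majoranaModule n κ :=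
  Submodule.sum_mem _ fun _ hs =>
    Submodule.smul_mem _ _ (basisOp_mem (Finset.mem_powersetCard.mp hs).2)

theorem component_add (κ : ℕ) (M N : Op n) :
    component κ (M + N) = component κ M + component κ N := by
  simp [component, mul_add, add_smul, Finset.sum_add_distrib]

theorem component_smul (κ : ℕ) (c : ℂ) (M : Op n) :
    component κ (c • M) = c • component κ M := by
  simp [component, Finset.smul_sum, smul_smul]

theorem component_basisOp (κ : ℕ) (s : Finset (Fin (2 * n))) :
    component κ (basisOp s : Op n) = if s.card = κ then basisOp s else 0 := by
  rw [component]
  have : ∀ t ∈ Finset.powersetCard κ (Finset.univ : Finset (Fin (2 * n))),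
      ((basisOp t : Op n) * basisOp s).trace • (basisOp t : Op n) =
        if t = s then basisOp s else 0 := by
    intro t _
    split_ifs with h
    · rw [h, trace_basisOp_mul_self, one_smul]
    · rw [trace_basisOp_mul h, zero_smul]
  rw [Finset.sum_congr rfl this, Finset.sum_ite_eq']
  simp [Finset.mem_powersetCard]

theorem majoranaProd_eq_smul (s : Finset (Fin (2 * n))) :
    ∃ c : ℂ, (majoranaProd s : Op n) = c • basisOp s := by
  have hc : (Complex.I ^ (s.card / 2) / ((Real.sqrt (2 ^ n) : ℝ) : ℂ)) ≠ 0 :=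
    div_ne_zero (pow_ne_zero _ Complex.I_ne_zero)
      (Complex.ofReal_ne_zero.mpr (Real.sqrt_ne_zero'.mpr (by positivity)))
  exact ⟨_, (inv_smul_smul₀ hc _).symm⟩

theorem component_of_mem {κ : ℕ} (κ' : ℕ) {M : Op n} (hM : M ∈ majoranaModule n κ) :
    component κ' M = if κ = κ' then M else 0 := by
  induction hM using Submodule.span_induction with
  | mem x hx =>
    obtain ⟨s, hs, rfl⟩ := hx
    obtain ⟨c, hc⟩ := majoranaProd_eq_smul s
    rw [hc, component_smul, component_basisOp, hs]
    split_ifs <;> simp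
  | zero => simp [component]
  | add x y _ _ hx hy => rw [component_add, hx, hy]; split_ifs <;> simp
  | smul a x _ hx => rw [component_smul, hx]; split_ifs <;> simp

theorem trace_component_mul_of_mem {κ : ℕ} {A : Op n} (hA : A ∈ majoranaModule n κ) (M : Op n) :
    (A * component κ M).trace = (A * M).trace := by
  have hA' := component_of_mem κ hA
  rw [if_pos rfl] at hA'
  rw [← hA', component, component, Finset.sum_mul, Finset.sum_mul, Matrix.trace_sum,
    Matrix.trace_sum]
  refine Finset.sum_congr rfl fun s hs => ?_
  rw [smul_mul_assoc, smul_mul_assoc, Matrix.trace_smul, Matrix.trace_smul, Finset.mul_sum,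
    Matrix.trace_sum, Finset.sum_eq_single_of_mem s hs]
  · rw [mul_smul_comm, Matrix.trace_smul, trace_basisOp_mul_self, smul_eq_mul, smul_eq_mul,
      smul_eq_mul, mul_one]
  · intro t _ hts
    rw [mul_smul_comm, Matrix.trace_smul, trace_basisOp_mul hts.symm, smul_zero]

theorem component_isHermitian (κ : ℕ) {M : Op n} (hM : M.IsHermitian) :
    (component κ M)ᴴ = component κ M := by
  rw [component, Matrix.conjTranspose_sum]
  refine Finset.sum_congr rfl fun s _ => ?_
  rw [Matrix.conjTranspose_smul, basisOp_conjTranspose, ← Matrix.trace_conjTranspose,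
    Matrix.conjTranspose_mul, basisOp_conjTranspose, hM.eq, Matrix.trace_mul_comm]

theorem majoranaModule_eq_span (κ : ℕ) : majoranaModule n κ =
    Submodule.span ℂ (Set.range fun s : Finset.powersetCard κ (Finset.univ : Finset (Fin (2 * n))) =>
      (basisOp (s : Finset (Fin (2 * n))) : Op n)) := by
  apply le_antisymm
  · intro M hM
    have h := component_of_mem κ hM
    rw [if_pos rfl] at h
    rw [← h]
    exact Submodule.sum_mem _ fun s hs =>
      Submodule.smul_mem _ _ (Submodule.subset_span ⟨⟨s, hs⟩, rfl⟩)
  · rw [Submodule.span_le]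
    rintro _ ⟨s, rfl⟩
    exact basisOp_mem (Finset.mem_powersetCard.mp s.2).2

theorem finrank_majoranaModule (κ : ℕ) :
    Module.finrank ℂ (majoranaModule n κ) = (2 * n).choose κ := by
  rw [majoranaModule_eq_span, finrank_span_eq_card]
  · simp
  · rw [Fintype.linearIndependent_iff]
    intro g hg s
    have h := congrArg (fun M : Op n => (basisOp (s : Finset (Fin (2 * n))) * M).trace) hg
    simp only [Finset.mul_sum, Matrix.trace_sum, mul_smul_comm, Matrix.trace_smul, mul_zero,
      Matrix.trace_zero] at h
    rw [Finset.sum_eq_single s] at h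
    · simpa [trace_basisOp_mul_self] using h
    · intro t _ hts
      rw [trace_basisOp_mul fun h' => hts (Subtype.ext h'.symm), smul_zero]
    · simp

end Matchgate

/-- A closed subspace that is stable under the commutator with `X` is stable under conjugation
by `exp X`. -/
theorem exp_mul_mul_exp_neg_mem {A : Type*} [NormedRing A] [NormedAlgebra ℂ A] [CompleteSpace A]
    {S : Submodule ℂ A} (hS : IsClosed (S : Set A)) {X : A} (hX : ∀ b ∈ S, X * b - b * X ∈ S)
    {b : A} (hb : b ∈ S) : NormedSpace.exp X * b * NormedSpace.exp (-X) ∈ S := by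
  have hsum : ∀ (T : A →L[ℂ] A) (a : A),
      HasSum (fun k : ℕ => ((k.factorial : ℂ)⁻¹) • (T ^ k) a) (NormedSpace.exp T a) := fun T a =>
    (NormedSpace.exp_series_hasSum_exp' (𝕂 := ℂ) T).mapL (ContinuousLinearMap.apply ℂ A a)
  set l : A →L[ℂ] A := ContinuousLinearMap.mul ℂ A X with hl
  set r : A →L[ℂ] A := (ContinuousLinearMap.mul ℂ A).flip (-X) with hr
  have hlp : ∀ (k : ℕ) (a : A), (l ^ k) a = X ^ k * a := by
    intro k
    induction k with
    | zero => simp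
    | succ k ih =>
      intro a
      rw [pow_succ', pow_succ', mul_apply_eq_comp, ih]
      simp [hl, mul_assoc]
  have hrp : ∀ (k : ℕ) (a : A), (r ^ k) a = a * (-X) ^ k := by
    intro k
    induction k with
    | zero => simp
    | succ k ih =>
      intro a
      rw [pow_succ', pow_succ, mul_apply_eq_comp, ih]
      simp only [hr, ContinuousLinearMap.flip_apply, ContinuousLinearMap.mul_apply', mul_assoc]
  have hle : ∀ a, NormedSpace.exp l a = NormedSpace.exp X * a := by
    intro a
    refine (hsum l a).unique ?_
    have := (NormedSpace.exp_series_hasSum_exp' (𝕂 := ℂ) X).mul_right a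
    simpa only [hlp, smul_mul_assoc] using this
  have hre : ∀ a, NormedSpace.exp r a = a * NormedSpace.exp (-X) := by
    intro a
    refine (hsum r a).unique ?_
    have := (NormedSpace.exp_series_hasSum_exp' (𝕂 := ℂ) (-X)).mul_left a
    simpa only [hrp, mul_smul_comm] using this
  have hcomm : Commute l r := by
    ext a
    simp [hl, hr, mul_assoc]
  have hadd : NormedSpace.exp (l + r) = NormedSpace.exp l * NormedSpace.exp r :=
    NormedSpace.exp_add_of_commute_of_mem_ball (𝕂 := ℂ) hcomm
      ((NormedSpace.expSeries_radius_eq_top ℂ (A →L[ℂ] A)).symm ▸ edist_lt_top _ _)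
      ((NormedSpace.expSeries_radius_eq_top ℂ (A →L[ℂ] A)).symm ▸ edist_lt_top _ _)
  have hmem : NormedSpace.exp (l + r) b ∈ S := by
    refine hS.mem_of_tendsto (hsum (l + r) b) (Filter.Eventually.of_forall fun F => ?_)
    refine Submodule.sum_mem _ fun k _ => Submodule.smul_mem _ _ ?_
    clear * - hX hb hl hr
    induction k with
    | zero => simpa using hb
    | succ k ih =>
      rw [pow_succ', mul_apply_eq_comp]
      have := hX _ ih
      simpa [hl, hr, sub_eq_add_neg] using this
  rw [hadd, mul_apply_eq_comp, hle, hre, ← mul_assoc] at hmem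
  exact hmem

/-- The exponential of a real multiple of a square root of `-1`. -/
theorem exp_smul_of_mul_self_eq_neg_one {A : Type*} [NormedRing A] [NormedAlgebra ℝ A]
    {x : A} (hx : x * x = -1) (t : ℝ) :
    NormedSpace.exp (t • x) = Real.cos t • 1 + Real.sin t • x := by
  set f : ℂ →ₐ[ℝ] A := Complex.lift ⟨x, hx⟩ with hf
  have hfx : ∀ z : ℂ, f z = z.re • 1 + z.im • x := by
    intro z
    simp [hf, Complex.liftAux_apply, Algebra.algebraMap_eq_smul_one]
  have hcont : Continuous f := f.toLinearMap.continuous_of_finiteDimensional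
  have h1 : f (NormedSpace.exp ((t : ℂ) * Complex.I)) = NormedSpace.exp (f ((t : ℂ) * Complex.I)) :=
    NormedSpace.map_exp_of_mem_ball (𝕂 := ℝ) f hcont _
      ((NormedSpace.expSeries_radius_eq_top ℝ ℂ).symm ▸ edist_lt_top _ _)
  have h2 : f ((t : ℂ) * Complex.I) = t • x := by rw [hfx]; simp
  rw [h2, ← Complex.exp_eq_exp_ℂ, hfx, Complex.exp_ofReal_mul_I_re,
    Complex.exp_ofReal_mul_I_im] at h1
  exact h1.symm

namespace Matchgate

attribute [local instance] LieRing.ofAssociativeRing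

variable {n : ℕ}

theorem exp_conj_mem {S : Submodule ℂ (Op n)} {X : Op n} (hX : ∀ b ∈ S, X * b - b * X ∈ S)
    {b : Op n} (hb : b ∈ S) : NormedSpace.exp X * b * NormedSpace.exp (-X) ∈ S := by
  let : NormedRing (Op n) := Matrix.linftyOpNormedRing
  let : NormedAlgebra ℂ (Op n) := Matrix.linftyOpNormedAlgebra
  exact exp_mul_mul_exp_neg_mem S.closed_of_finiteDimensional hX hb

theorem exp_smul_of_mul_self {x : Op n} (hx : x * x = -1) (t : ℝ) :
    NormedSpace.exp (t • x) = Real.cos t • 1 + Real.sin t • x := by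
  let : NormedRing (Op n) := Matrix.linftyOpNormedRing
  let : NormedAlgebra ℝ (Op n) := Matrix.linftyOpNormedAlgebra
  exact exp_smul_of_mul_self_eq_neg_one hx t

theorem pair_mul_self {a b : Fin (2 * n)} (h : a ≠ b) :
    (majorana a * majorana b : Op n) * (majorana a * majorana b) = -1 := by
  rw [← mul_assoc, pair_mul_majorana h, if_pos (Or.inl rfl), ← mul_assoc, majorana_mul_self,
    one_mul, neg_one_smul, neg_mul, majorana_mul_self]

theorem pair_conjTranspose {a b : Fin (2 * n)} (h : a ≠ b) :
    (majorana a * majorana b : Op n)ᴴ = -(majorana a * majorana b) := by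
  rw [Matrix.conjTranspose_mul, majorana_conjTranspose, majorana_conjTranspose,
    majorana_mul_comm h.symm]

theorem adjacent_pair_eq {a b : Fin (2 * n)} (h : (b : ℕ) = a + 1) :
    ∃ H ∈ generators n, (majorana a * majorana b : Op n) = Complex.I • H := by
  obtain ⟨a, ha⟩ := a
  obtain ⟨b, hb⟩ := b
  simp only at h
  subst h
  rcases Nat.even_or_odd' a with ⟨j, rfl | rfl⟩
  · exact ⟨_, Or.inl ⟨⟨j, by omega⟩, rfl⟩, majorana_even_mul_odd ⟨j, by omega⟩⟩
  · exact ⟨_, Or.inr ⟨⟨j, by omega⟩, ⟨j + 1, by omega⟩, rfl, rfl⟩,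
      majorana_odd_mul_even ⟨j, by omega⟩ ⟨j + 1, by omega⟩ rfl⟩

theorem generator_eq {H : Op n} (hH : H ∈ generators n) :
    ∃ a b : Fin (2 * n), a ≠ b ∧ Complex.I • H = majorana a * majorana b := by
  rcases hH with ⟨j, rfl⟩ | ⟨i, j, hij, rfl⟩
  · exact ⟨⟨2 * j, by omega⟩, ⟨2 * j + 1, by omega⟩, by simp, (majorana_even_mul_odd j).symm⟩
  · exact ⟨⟨2 * i + 1, by omega⟩, ⟨2 * i + 2, by omega⟩, by simp,
      (majorana_odd_mul_even i j hij).symm⟩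

theorem pair_mem_dla_of_lt (k : ℕ) : ∀ a b : Fin (2 * n), (b : ℕ) = a + k + 1 →
    (majorana a * majorana b : Op n) ∈ dla n := by
  induction k with
  | zero =>
    intro a b h
    obtain ⟨H, hH, e⟩ := adjacent_pair_eq (n := n) (a := a) (b := b) (by omega)
    exact LieSubalgebra.subset_lieSpan ⟨H, hH, e⟩
  | succ k ih =>
    intro a b h
    set c : Fin (2 * n) := ⟨a + k + 1, by omega⟩ with hc
    have h1 := ih a c rfl
    obtain ⟨H, hH, e⟩ := adjacent_pair_eq (n := n) (a := c) (b := b) (by simp only [hc]; omega)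
    have h2 : (majorana c * majorana b : Op n) ∈ dla n := LieSubalgebra.subset_lieSpan ⟨H, hH, e⟩
    have hca : c ≠ a := by rw [Ne, Fin.ext_iff]; simp only [hc]; omega
    have hcb : c ≠ b := by rw [Ne, Fin.ext_iff]; simp only [hc]; omega
    have hab : a ≠ b := by rw [Ne, Fin.ext_iff]; omega
    have h3 := (dla n).lie_mem h1 h2
    have h4 : ⁅(majorana a * majorana c : Op n), majorana c * majorana b⁆ =
        (2 : ℝ) • (majorana a * majorana b) := by
      have e1 : (majorana a * majorana c : Op n) * (majorana c * majorana b) =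
          majorana a * majorana b := by
        rw [mul_assoc, ← mul_assoc (majorana c), majorana_mul_self, one_mul]
      have e2 : (majorana c * majorana b : Op n) * (majorana a * majorana c) =
          -(majorana a * majorana b) := by
        rw [← mul_assoc, pair_mul_majorana hcb, if_neg (by simp [hca.symm, hab]), one_smul,
          mul_assoc, pair_mul_majorana hcb, if_pos (Or.inl rfl), ← mul_assoc (majorana c),
          majorana_mul_self, one_mul, neg_one_smul, mul_neg]
      rw [Ring.lie_def, e1, e2, sub_neg_eq_add, two_smul]
    rw [h4] at h3
    have h5 := (dla n).smul_mem (2⁻¹ : ℝ) h3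
    rwa [smul_smul, inv_mul_cancel₀ two_ne_zero, one_smul] at h5

theorem pair_mem_dla {a b : Fin (2 * n)} (h : a ≠ b) :
    (majorana a * majorana b : Op n) ∈ dla n := by
  rcases lt_or_gt_of_ne h with h' | h'
  · exact pair_mem_dla_of_lt (b - a - 1) a b (by have : (a : ℕ) < b := h'; omega)
  · rw [majorana_mul_comm h]
    exact (dla n).neg_mem (pair_mem_dla_of_lt (a - b - 1) b a (by have : (b : ℕ) < a := h'; omega))

theorem mem_matchgateGroup_of_exp {X : Op n} (hX : X ∈ dla n)
    {u : Matrix.unitaryGroup (Qubits n) ℂ} (hu : (u : Op n) = NormedSpace.exp X) :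
    u ∈ matchgateGroup n :=
  Subgroup.le_topologicalClosure _ (Subgroup.subset_closure ⟨X, hX, hu⟩)

/-- The sign flip of two Majorana operators. -/
theorem pair_mem_matchgateGroup {a b : Fin (2 * n)} (h : a ≠ b) :
    ∃ g : matchgateGroup n, ((g : Matrix.unitaryGroup (Qubits n) ℂ) : Op n) =
      majorana a * majorana b := by
  have hu : (majorana a * majorana b : Op n) ∈ Matrix.unitaryGroup (Qubits n) ℂ := by
    rw [Matrix.mem_unitaryGroup_iff, Matrix.star_eq_conjTranspose, pair_conjTranspose h, mul_neg,
      pair_mul_self h, neg_neg]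
  refine ⟨⟨⟨_, hu⟩, mem_matchgateGroup_of_exp ((dla n).smul_mem (Real.pi / 2) (pair_mem_dla h)) ?_⟩,
    rfl⟩
  rw [exp_smul_of_mul_self (pair_mul_self h), Real.cos_pi_div_two, Real.sin_pi_div_two]
  simp

/-- The signed exchange of two Majorana operators. -/
theorem exchange_mem_matchgateGroup {a b : Fin (2 * n)} (h : a ≠ b) :
    ∃ g : matchgateGroup n, ((g : Matrix.unitaryGroup (Qubits n) ℂ) : Op n) =
      (√2 / 2 : ℝ) • (1 + majorana a * majorana b) := by
  have hu : ((√2 / 2 : ℝ) • (1 + majorana a * majorana b) : Op n) ∈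
      Matrix.unitaryGroup (Qubits n) ℂ := by
    rw [Matrix.mem_unitaryGroup_iff, Matrix.star_eq_conjTranspose, Matrix.conjTranspose_smul,
      Matrix.conjTranspose_add, Matrix.conjTranspose_one, pair_conjTranspose h, smul_mul_smul_comm]
    have e : (1 + majorana a * majorana b : Op n) * (1 + -(majorana a * majorana b)) =
        (2 : ℝ) • 1 := by
      rw [add_mul, mul_add, mul_add, mul_neg, mul_neg, pair_mul_self h, two_smul]
      simp
    rw [e, smul_smul, star_trivial]
    have : (√2 / 2 * (√2 / 2) * 2 : ℝ) = 1 := by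
      have := Real.mul_self_sqrt (show (0 : ℝ) ≤ 2 by norm_num)
      linarith
    rw [this, one_smul]
  refine ⟨⟨⟨_, hu⟩, mem_matchgateGroup_of_exp ((dla n).smul_mem (Real.pi / 4) (pair_mem_dla h)) ?_⟩,
    rfl⟩
  rw [exp_smul_of_mul_self (pair_mul_self h), Real.cos_pi_div_four, Real.sin_pi_div_four,
    ← smul_add]

/-- The operators that commute with the parity and whose commutator preserves `𝓑_κ`. -/
def moduleNormalizer (n κ : ℕ) : LieSubalgebra ℝ (Op n) where
  carrier := {X | (∀ b ∈ majoranaModule n κ, X * b - b * X ∈ majoranaModule n κ) ∧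
    Commute X (parity n)}
  zero_mem' := ⟨by simp, .zero_left _⟩
  add_mem' := by
    rintro X Y ⟨hX, hX'⟩ ⟨hY, hY'⟩
    refine ⟨fun b hb => ?_, hX'.add_left hY'⟩
    have := add_mem (hX b hb) (hY b hb)
    convert this using 1
    noncomm_ring
  smul_mem' := by
    rintro c X ⟨hX, hX'⟩
    refine ⟨fun b hb => ?_, hX'.smul_left c⟩
    have := Submodule.smul_mem _ (c : ℂ) (hX b hb)
    rwa [smul_sub, ← smul_mul_assoc, ← mul_smul_comm, Complex.coe_smul] at this
  lie_mem' := by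
    rintro X Y ⟨hX, hX'⟩ ⟨hY, hY'⟩
    refine ⟨fun b hb => ?_, ?_⟩
    · have := sub_mem (hX _ (hY b hb)) (hY _ (hX b hb))
      convert this using 1
      rw [Ring.lie_def]
      noncomm_ring
    · rw [Ring.lie_def]
      exact (hX'.mul_left hY').sub_left (hY'.mul_left hX')

theorem card_symmDiff_pair {a b : Fin (2 * n)} {s : Finset (Fin (2 * n))} (ha : a ∈ s)
    (hb : b ∉ s) : (symmDiff {a} (symmDiff {b} s)).card = s.card := by
  have h : symmDiff {a} (symmDiff {b} s) = insert b (s.erase a) := by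
    have hab : a ≠ b := fun h => hb (h ▸ ha)
    ext c
    by_cases hca : c = a
    · subst hca; simp [Finset.mem_symmDiff, ha, hab]
    · by_cases hcb : c = b
      · subst hcb; simp [Finset.mem_symmDiff, hb, hca]
      · simp [Finset.mem_symmDiff, hca, hcb]
  rw [h, Finset.card_insert_of_notMem (fun h' => hb (Finset.mem_of_mem_erase h')),
    Finset.card_erase_of_mem ha]
  have : 0 < s.card := Finset.card_pos.mpr ⟨a, ha⟩
  omega

theorem pair_mul_majoranaProd_eqUpToSign (a b : Fin (2 * n)) (s : Finset (Fin (2 * n))) :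
    EqUpToSign (majorana a * majorana b * majoranaProd s : Op n)
      (majoranaProd (symmDiff {a} (symmDiff {b} s))) := by
  rw [mul_assoc]
  exact ((majorana_mul_majoranaProd b s).mul_left _).trans (majorana_mul_majoranaProd _ _)

theorem pair_mem_moduleNormalizer (κ : ℕ) {a b : Fin (2 * n)} (h : a ≠ b) :
    (majorana a * majorana b : Op n) ∈ moduleNormalizer n κ := by
  refine ⟨fun M hM => ?_, ?_⟩
  · induction hM using Submodule.span_induction with
    | mem x hx =>
      obtain ⟨s, hs, rfl⟩ := hx
      have e := pair_mul_majoranaProd h s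
      have hmem : ∀ a b : Fin (2 * n), a ∈ s → b ∉ s →
          (majorana a * majorana b * majoranaProd s : Op n) ∈ majoranaModule n κ :=
        fun a b ha hb => (pair_mul_majoranaProd_eqUpToSign a b s).mem
          (majoranaProd_mem _ ((card_symmDiff_pair ha hb).trans hs))
      have key : (majorana a * majorana b * majoranaProd s : Op n) ∈ majoranaModule n κ →
          (majorana a * majorana b * majoranaProd s : Op n) =
            -(majoranaProd s * (majorana a * majorana b)) →
          majorana a * majorana b * majoranaProd s - majoranaProd s * (majorana a * majorana b) ∈
            majoranaModule n κ := by
        intro h1 h2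
        rw [← neg_eq_iff_eq_neg.mpr h2, sub_neg_eq_add]
        exact add_mem h1 h1
      by_cases ha : a ∈ s <;> by_cases hb : b ∈ s
      · simp [e, ha, hb]
      · exact key (hmem a b ha hb) (by simp [e, ha, hb])
      · refine key ?_ (by simp [e, ha, hb])
        rw [majorana_mul_comm h, neg_mul]
        exact Submodule.neg_mem _ (hmem b a hb ha)
      · simp [e, ha, hb]
    | zero => simp
    | add x y _ _ hx hy =>
      have := add_mem hx hy
      convert this using 1
      noncomm_ring
    | smul c x _ hx =>
      have := Submodule.smul_mem _ c hx
      rwa [mul_smul_comm, smul_mul_assoc, ← smul_sub]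
  · rw [commute_iff_eq, mul_assoc, ← neg_eq_iff_eq_neg.mpr (parity_mul_majorana b), mul_neg,
      ← mul_assoc, ← neg_eq_iff_eq_neg.mpr (parity_mul_majorana a), neg_mul, neg_neg, mul_assoc]

theorem dla_le_moduleNormalizer (n κ : ℕ) : dla n ≤ moduleNormalizer n κ := by
  rw [dla, LieSubalgebra.lieSpan_le]
  rintro X ⟨H, hH, rfl⟩
  obtain ⟨a, b, hab, e⟩ := generator_eq hH
  rw [e]
  exact pair_mem_moduleNormalizer κ hab

/-- The unitaries that commute with the parity and whose conjugation preserves `𝓑_κ`. -/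
def moduleStabilizer (n κ : ℕ) : Subgroup (Matrix.unitaryGroup (Qubits n) ℂ) where
  carrier := {u | (∀ b ∈ majoranaModule n κ, (u : Op n) * b * (u : Op n)ᴴ ∈ majoranaModule n κ) ∧
    (∀ b ∈ majoranaModule n κ, (u : Op n)ᴴ * b * (u : Op n) ∈ majoranaModule n κ) ∧
    (u : Op n) * parity n * (u : Op n)ᴴ = parity n}
  one_mem' := by simp
  mul_mem' := by
    rintro u v ⟨hu, hu', hu''⟩ ⟨hv, hv', hv''⟩
    refine ⟨fun b hb => ?_, fun b hb => ?_, ?_⟩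
    · simpa [Matrix.conjTranspose_mul, mul_assoc] using hu _ (hv b hb)
    · simpa [Matrix.conjTranspose_mul, mul_assoc] using hv' _ (hu' b hb)
    · conv_rhs => rw [← hu'', ← hv'']
      simp [Matrix.conjTranspose_mul, mul_assoc]
  inv_mem' := by
    rintro u ⟨hu, hu', hu''⟩
    have h1 : (((u⁻¹ : Matrix.unitaryGroup (Qubits n) ℂ)) : Op n) = (u : Op n)ᴴ := rfl
    have h2 : (u : Op n)ᴴ * u = 1 := Matrix.UnitaryGroup.star_mul_self u
    refine ⟨fun b hb => ?_, fun b hb => ?_, ?_⟩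
    · rw [h1, Matrix.conjTranspose_conjTranspose]; exact hu' b hb
    · rw [h1, Matrix.conjTranspose_conjTranspose]; exact hu b hb
    · rw [h1, Matrix.conjTranspose_conjTranspose]
      nth_rw 1 [← hu'']
      rw [mul_assoc, mul_assoc, h2, mul_one, ← mul_assoc, h2, one_mul]

theorem isClosed_moduleStabilizer (n κ : ℕ) :
    IsClosed (moduleStabilizer n κ : Set (Matrix.unitaryGroup (Qubits n) ℂ)) := by
  have hB : IsClosed (majoranaModule n κ : Set (Op n)) := by
    let : NormedAddCommGroup (Op n) := Matrix.linftyOpNormedAddCommGroup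
    let : NormedSpace ℂ (Op n) := Matrix.linftyOpNormedSpace
    exact Submodule.closed_of_finiteDimensional _
  have h1 : IsClosed {u : Matrix.unitaryGroup (Qubits n) ℂ | ∀ b ∈ majoranaModule n κ,
      (u : Op n) * b * (u : Op n)ᴴ ∈ majoranaModule n κ} := by
    simp only [Set.ofPred_forall]
    exact isClosed_iInter fun b => isClosed_iInter fun _ => hB.preimage (by fun_prop)
  have h2 : IsClosed {u : Matrix.unitaryGroup (Qubits n) ℂ | ∀ b ∈ majoranaModule n κ,
      (u : Op n)ᴴ * b * (u : Op n) ∈ majoranaModule n κ} := by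
    simp only [Set.ofPred_forall]
    exact isClosed_iInter fun b => isClosed_iInter fun _ => hB.preimage (by fun_prop)
  have h3 : IsClosed {u : Matrix.unitaryGroup (Qubits n) ℂ |
      (u : Op n) * parity n * (u : Op n)ᴴ = parity n} :=
    isClosed_eq (by fun_prop) (by fun_prop)
  exact h1.inter (h2.inter h3)

theorem matchgateGroup_le_moduleStabilizer (n κ : ℕ) :
    matchgateGroup n ≤ moduleStabilizer n κ := by
  refine Subgroup.topologicalClosure_minimal _ ?_ (isClosed_moduleStabilizer n κ)
  rw [Subgroup.closure_le]
  rintro u ⟨X, hX, hu⟩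
  obtain ⟨hX1, hX2⟩ := dla_le_moduleNormalizer n κ hX
  have hneg : (u : Op n)ᴴ = NormedSpace.exp (-X) := by
    rw [Matrix.exp_neg, ← hu]
    exact (Matrix.inv_eq_right_inv (Matrix.mem_unitaryGroup_iff.mp u.2)).symm
  have hunit : (u : Op n) * (u : Op n)ᴴ = 1 := Matrix.mem_unitaryGroup_iff.mp u.2
  refine ⟨fun b hb => ?_, fun b hb => ?_, ?_⟩
  · rw [hneg, hu]
    exact exp_conj_mem hX1 hb
  · rw [hneg, hu]
    have := exp_conj_mem (X := -X) (fun b hb => by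
      have := Submodule.neg_mem _ (hX1 b hb)
      convert this using 1
      noncomm_ring) hb
    rwa [neg_neg] at this
  · have hc : Commute (u : Op n) (parity n) := by rw [hu]; exact hX2.exp_left
    rw [hc.eq, mul_assoc, hunit, mul_one]

end Matchgate

namespace Matchgate

open MeasureTheory

variable {n : ℕ}

/-- The operator of an element of the matchgate group. -/
abbrev groupOp (g : matchgateGroup n) : Op n := ((g : Matrix.unitaryGroup (Qubits n) ℂ) : Op n)

theorem groupOp_mul (g h : matchgateGroup n) : groupOp (g * h) = groupOp g * groupOp h := rfl

theorem conjTranspose_groupOp_mul_self (g : matchgateGroup n) : (groupOp g)ᴴ * groupOp g = 1 :=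
  Matrix.UnitaryGroup.star_mul_self _

theorem groupOp_conj_mem (g : matchgateGroup n) {κ : ℕ} {b : Op n} (hb : b ∈ majoranaModule n κ) :
    groupOp g * b * (groupOp g)ᴴ ∈ majoranaModule n κ :=
  (matchgateGroup_le_moduleStabilizer n κ g.2).1 b hb

theorem groupOp_conj_mem' (g : matchgateGroup n) {κ : ℕ} {b : Op n} (hb : b ∈ majoranaModule n κ) :
    (groupOp g)ᴴ * b * groupOp g ∈ majoranaModule n κ :=
  (matchgateGroup_le_moduleStabilizer n κ g.2).2.1 b hb

theorem groupOp_mul_parity (g : matchgateGroup n) :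
    groupOp g * parity n = parity n * groupOp g := by
  have h : groupOp g * parity n * (groupOp g)ᴴ = parity n :=
    (matchgateGroup_le_moduleStabilizer n 0 g.2).2.2
  calc groupOp g * parity n = groupOp g * parity n * (groupOp g)ᴴ * groupOp g := by
        rw [mul_assoc _ _ (groupOp g), conjTranspose_groupOp_mul_self, mul_one]
    _ = _ := by rw [h]

theorem component_eq_of_trace_eq {κ : ℕ} {M N : Op n} (hN : N ∈ majoranaModule n κ)
    (h : ∀ A ∈ majoranaModule n κ, (A * N).trace = (A * M).trace) : component κ M = N := by
  have e := component_of_mem κ hN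
  rw [if_pos rfl] at e
  rw [← e, component, component]
  exact Finset.sum_congr rfl fun s hs => by
    rw [h _ (basisOp_mem (Finset.mem_powersetCard.mp hs).2)]

theorem component_groupOp_conj (g : matchgateGroup n) (κ : ℕ) (M : Op n) :
    component κ (groupOp g * M * (groupOp g)ᴴ) = groupOp g * component κ M * (groupOp g)ᴴ := by
  have hrot : ∀ A N : Op n, (A * (groupOp g * N * (groupOp g)ᴴ)).trace =
      ((groupOp g)ᴴ * A * groupOp g * N).trace := by
    intro A N
    rw [← mul_assoc, Matrix.trace_mul_comm]
    simp only [mul_assoc]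
  refine component_eq_of_trace_eq (groupOp_conj_mem g (component_mem κ M)) fun A hA => ?_
  rw [hrot, hrot, trace_component_mul_of_mem (groupOp_conj_mem' g hA)]

theorem loss_add (ρ C D U : Op n) : loss ρ (C + D) U = loss ρ C U + loss ρ D U := by
  simp [loss, mul_add]

theorem loss_smul (ρ C U : Op n) (c : ℂ) : loss ρ (c • C) U = c * loss ρ C U := by
  simp [loss]

theorem loss_mul (ρ C U V : Op n) : loss ρ C (U * V) = loss ρ (Uᴴ * C * U) V := by
  simp only [loss, Matrix.conjTranspose_mul, mul_assoc]
  rw [Matrix.trace_mul_comm]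
  simp only [mul_assoc]

instance haar_isHaarMeasure (n : ℕ) : (haar n).IsHaarMeasure := by
  unfold haar; infer_instance

instance haar_isProbabilityMeasure (n : ℕ) : IsProbabilityMeasure (haar n) :=
  ⟨Measure.haarMeasure_self⟩

/-- Continuous functions of a continuous random unitary are integrable. -/
theorem integrable_comp_unitary {Θ : Type*} [TopologicalSpace Θ] [MeasurableSpace Θ]
    [OpensMeasurableSpace Θ] (μ : Measure Θ) [IsFiniteMeasure μ]
    {U : Θ → Matrix.unitaryGroup (Qubits n) ℂ} (hU : Continuous U)
    {F : Matrix.unitaryGroup (Qubits n) ℂ → ℂ} (hF : Continuous F) :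
    Integrable (fun θ => F (U θ)) μ := by
  obtain ⟨C, hC⟩ := isCompact_univ.exists_bound_of_continuousOn hF.continuousOn
  exact Integrable.of_bound (hF.comp hU).aestronglyMeasurable C
    (Filter.Eventually.of_forall fun θ => hC _ (Set.mem_univ _))

theorem continuous_loss (ρ C : Op n) :
    Continuous fun u : Matrix.unitaryGroup (Qubits n) ℂ => loss ρ C u := by
  unfold loss
  fun_prop

theorem integrable_loss (ρ C : Op n) :
    Integrable (fun g : matchgateGroup n => loss ρ C (groupOp g)) (haar n) :=
  integrable_comp_unitary (U := fun g : matchgateGroup n => g.1) (F := fun u => loss ρ C u) (haar n)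
    continuous_subtype_val (continuous_loss ρ C)

theorem integrable_loss_mul_loss (ρ C D : Op n) :
    Integrable (fun g : matchgateGroup n => loss ρ C (groupOp g) * loss ρ D (groupOp g))
      (haar n) :=
  integrable_comp_unitary (U := fun g : matchgateGroup n => g.1)
    (F := fun u => loss ρ C u * loss ρ D u) (haar n) continuous_subtype_val
    ((continuous_loss ρ C).mul (continuous_loss ρ D))

/-- The Haar average of the loss, as a linear form in the observable. -/
def firstMoment (ρ : Op n) : Op n →ₗ[ℂ] ℂ where
  toFun C := ∫ g, loss ρ C (groupOp g) ∂(haar n)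
  map_add' C D := by
    simp only [loss_add]
    exact integral_add (integrable_loss ρ C) (integrable_loss ρ D)
  map_smul' c C := by
    simp only [loss_smul]
    exact integral_const_mul c _

/-- The Haar average of products of two losses, as a bilinear form in the observables. -/
def secondMoment (ρ : Op n) : Op n →ₗ[ℂ] Op n →ₗ[ℂ] ℂ :=
  LinearMap.mk₂ ℂ (fun C D => ∫ g, loss ρ C (groupOp g) * loss ρ D (groupOp g) ∂(haar n))
    (fun C C' D => by
      simp only [loss_add, add_mul]
      exact integral_add (integrable_loss_mul_loss ρ C D) (integrable_loss_mul_loss ρ C' D))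
    (fun c C D => by
      simp only [loss_smul, mul_assoc]
      exact integral_const_mul c _)
    (fun C D D' => by
      simp only [loss_add, mul_add]
      exact integral_add (integrable_loss_mul_loss ρ C D) (integrable_loss_mul_loss ρ C D'))
    (fun c C D => by
      simp only [loss_smul, mul_left_comm _ c]
      exact integral_const_mul c _)

theorem firstMoment_apply (ρ C : Op n) :
    firstMoment ρ C = ∫ g, loss ρ C (groupOp g) ∂(haar n) := rfl

theorem secondMoment_apply (ρ C D : Op n) :
    secondMoment ρ C D = ∫ g, loss ρ C (groupOp g) * loss ρ D (groupOp g) ∂(haar n) := rfl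

theorem secondMoment_comm (ρ C D : Op n) : secondMoment ρ C D = secondMoment ρ D C := by
  simp only [secondMoment_apply, mul_comm]

theorem firstMoment_conj (ρ C : Op n) (h : matchgateGroup n) :
    firstMoment ρ ((groupOp h)ᴴ * C * groupOp h) = firstMoment ρ C := by
  rw [firstMoment_apply, firstMoment_apply,
    ← integral_mul_left_eq_self (fun g => loss ρ C (groupOp g)) h]
  simp only [groupOp_mul, loss_mul]

theorem secondMoment_conj (ρ C D : Op n) (h : matchgateGroup n) :
    secondMoment ρ ((groupOp h)ᴴ * C * groupOp h) ((groupOp h)ᴴ * D * groupOp h) =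
      secondMoment ρ C D := by
  rw [secondMoment_apply, secondMoment_apply,
    ← integral_mul_left_eq_self (fun g => loss ρ C (groupOp g) * loss ρ D (groupOp g)) h]
  simp only [groupOp_mul, loss_mul]

theorem exists_flip {a b : Fin (2 * n)} (hab : a ≠ b) : ∃ h : matchgateGroup n,
    ∀ s : Finset (Fin (2 * n)), (groupOp h)ᴴ * basisOp s * groupOp h =
      ((if a ∈ s then (-1 : ℂ) else 1) * (if b ∈ s then (-1 : ℂ) else 1)) • (basisOp s : Op n) := by
  obtain ⟨h, hh⟩ := pair_mem_matchgateGroup hab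
  refine ⟨h, fun s => ?_⟩
  rw [groupOp, hh, basisOp, mul_smul_comm, smul_mul_assoc, pair_conjTranspose hab, neg_mul,
    pair_mul_majoranaProd hab, neg_mul, smul_mul_assoc, mul_assoc, pair_mul_self hab, mul_neg,
    mul_one, smul_neg, smul_neg, smul_neg, neg_neg, smul_comm]

theorem exists_exchange {a b : Fin (2 * n)} {s : Finset (Fin (2 * n))} (ha : a ∈ s) (hb : b ∉ s) :
    ∃ h : matchgateGroup n, EqUpToSign ((groupOp h)ᴴ * basisOp s * groupOp h)
      (basisOp (symmDiff {a} (symmDiff {b} s))) := by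
  have hab : a ≠ b := fun h => hb (h ▸ ha)
  obtain ⟨h, hh⟩ := exchange_mem_matchgateGroup hab
  refine ⟨h, ?_⟩
  set x : Op n := majorana a * majorana b with hx
  have hxx : x * x = -1 := pair_mul_self hab
  have hxs : majoranaProd s * x = -(x * majoranaProd s) := by
    rw [hx, pair_mul_majoranaProd hab]; simp [ha, hb]
  have h2 : (√2 / 2 * (√2 / 2) : ℝ) = 1 / 2 := by
    have := Real.mul_self_sqrt (show (0 : ℝ) ≤ 2 by norm_num)
    linarith
  have e : (groupOp h)ᴴ * majoranaProd s * groupOp h = -(x * majoranaProd s) := by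
    have e1 : (1 + -x) * majoranaProd s * (1 + x) = (2 : ℝ) • -(x * majoranaProd s) := by
      have e2 : x * majoranaProd s * x = majoranaProd s := by
        rw [mul_assoc, hxs, mul_neg, ← mul_assoc, hxx, neg_mul, one_mul, neg_neg]
      rw [add_mul, add_mul, mul_add, mul_add, neg_mul, neg_mul, neg_mul, e2, one_mul, mul_one,
        mul_one, hxs, two_smul]
      abel
    rw [groupOp, hh, Matrix.conjTranspose_smul, Matrix.conjTranspose_add,
      Matrix.conjTranspose_one, hx, pair_conjTranspose hab, ← hx, star_trivial, smul_mul_assoc,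
      smul_mul_smul_comm, e1, smul_smul, h2]
    norm_num
  rw [basisOp, basisOp, card_symmDiff_pair ha hb, mul_smul_comm, smul_mul_assoc, e]
  refine EqUpToSign.smul _ ?_
  exact EqUpToSign.trans (Or.inr rfl) (pair_mul_majoranaProd_eqUpToSign a b s)

theorem firstMoment_basisOp (ρ : Op n) {s : Finset (Fin (2 * n))} (h0 : 0 < s.card)
    (h1 : s.card < 2 * n) : firstMoment ρ (basisOp s) = 0 := by
  obtain ⟨a, ha⟩ := Finset.card_pos.mp h0
  obtain ⟨b, hb⟩ : ∃ b, b ∉ s := by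
    by_contra! h
    rw [Finset.eq_univ_of_forall h, Finset.card_univ, Fintype.card_fin] at h1
    exact lt_irrefl _ h1
  obtain ⟨h, hh⟩ := exists_flip (n := n) (a := a) (b := b) fun e => hb (e ▸ ha)
  have e := firstMoment_conj ρ (basisOp s) h
  rw [hh, if_pos ha, if_neg hb, mul_one, neg_one_smul, map_neg] at e
  exact self_eq_neg.mp e.symm

theorem firstMoment_eq_zero (ρ : Op n) {κ : ℕ} (h0 : 0 < κ) (h1 : κ < 2 * n) {C : Op n}
    (hC : C ∈ majoranaModule n κ) : firstMoment ρ C = 0 := by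
  have e := component_of_mem κ hC
  rw [if_pos rfl] at e
  rw [← e, component, map_sum]
  refine Finset.sum_eq_zero fun s hs => ?_
  have hs' := (Finset.mem_powersetCard.mp hs).2
  rw [map_smul, firstMoment_basisOp ρ (by omega) (by omega), smul_zero]

theorem conj_mul_of_commute {Γ : Op n} (hΓ : ∀ g : matchgateGroup n, Commute (groupOp g)ᴴ Γ)
    (h : matchgateGroup n) (C : Op n) :
    (groupOp h)ᴴ * (Γ * C) * groupOp h = Γ * ((groupOp h)ᴴ * C * groupOp h) := by
  rw [← mul_assoc, (hΓ h).eq]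
  simp only [mul_assoc]

theorem secondMoment_basisOp_eq_zero (ρ : Op n) {Γ : Op n}
    (hΓ : ∀ g : matchgateGroup n, Commute (groupOp g)ᴴ Γ) {s t : Finset (Fin (2 * n))}
    (h1 : s ≠ t) (h2 : s.card + t.card ≠ 2 * n) :
    secondMoment ρ (basisOp s) (Γ * basisOp t) = 0 := by
  obtain ⟨a, ha⟩ : (symmDiff s t).Nonempty :=
    Finset.nonempty_iff_ne_empty.mpr fun e => h1 (symmDiff_eq_bot.mp e)
  obtain ⟨b, hb⟩ : ∃ b, b ∉ symmDiff s t := by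
    by_contra! h
    have e : t = sᶜ := by
      ext c
      have := h c
      rw [Finset.mem_symmDiff] at this
      rw [Finset.mem_compl]
      tauto
    rw [e, Finset.card_add_card_compl, Fintype.card_fin] at h2
    exact h2 rfl
  have hab : a ≠ b := fun e => hb (e ▸ ha)
  obtain ⟨h, hh⟩ := exists_flip hab
  have e := secondMoment_conj ρ (basisOp s) (Γ * basisOp t) h
  rw [conj_mul_of_commute hΓ, hh, hh, mul_smul_comm, map_smul, map_smul, LinearMap.smul_apply,
    smul_smul] at e
  have hc : (((if a ∈ t then (-1 : ℂ) else 1) * (if b ∈ t then (-1 : ℂ) else 1)) *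
      ((if a ∈ s then (-1 : ℂ) else 1) * (if b ∈ s then (-1 : ℂ) else 1))) = -1 := by
    rw [Finset.mem_symmDiff] at ha hb
    by_cases h1 : a ∈ s <;> by_cases h2 : a ∈ t <;> by_cases h3 : b ∈ s <;> by_cases h4 : b ∈ t <;>
      simp_all
  rw [hc, neg_one_smul] at e
  exact self_eq_neg.mp e.symm

theorem secondMoment_basisOp_exchange (ρ : Op n) {Γ : Op n}
    (hΓ : ∀ g : matchgateGroup n, Commute (groupOp g)ᴴ Γ) {s : Finset (Fin (2 * n))}
    {a b : Fin (2 * n)} (ha : a ∈ s) (hb : b ∉ s) :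
    secondMoment ρ (basisOp s) (Γ * basisOp s) =
      secondMoment ρ (basisOp (symmDiff {a} (symmDiff {b} s)))
        (Γ * basisOp (symmDiff {a} (symmDiff {b} s))) := by
  obtain ⟨h, hh⟩ := exists_exchange ha hb
  rw [← secondMoment_conj ρ _ _ h, conj_mul_of_commute hΓ]
  rcases hh with e | e
  · rw [e]
  · rw [e, mul_neg, map_neg, map_neg, LinearMap.neg_apply, neg_neg]

theorem secondMoment_basisOp_eq (ρ : Op n) {Γ : Op n}
    (hΓ : ∀ g : matchgateGroup n, Commute (groupOp g)ᴴ Γ) (k : ℕ) :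
    ∀ s t : Finset (Fin (2 * n)), s.card = t.card → (s \ t).card = k →
      secondMoment ρ (basisOp s) (Γ * basisOp s) = secondMoment ρ (basisOp t) (Γ * basisOp t) := by
  induction k with
  | zero =>
    intro s t hst hk
    rw [Finset.card_eq_zero, Finset.sdiff_eq_empty_iff_subset] at hk
    rw [Finset.eq_of_subset_of_card_le hk hst.ge]
  | succ k ih =>
    intro s t hst hk
    obtain ⟨a, ha⟩ : (s \ t).Nonempty := Finset.card_pos.mp (by omega)
    have hk' : (t \ s).card = k + 1 := by rw [← hk, Finset.card_sdiff_comm hst]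
    obtain ⟨b, hb⟩ : (t \ s).Nonempty := Finset.card_pos.mp (by omega)
    have ha' := Finset.mem_sdiff.mp ha
    have hb' := Finset.mem_sdiff.mp hb
    rw [secondMoment_basisOp_exchange ρ hΓ ha'.1 hb'.2]
    refine ih _ _ ((card_symmDiff_pair ha'.1 hb'.2).trans hst) ?_
    have e : symmDiff {a} (symmDiff {b} s) \ t = (s \ t).erase a := by
      ext c
      simp only [Finset.mem_sdiff, Finset.mem_symmDiff, Finset.mem_singleton, Finset.mem_erase]
      by_cases hca : c = a
      · subst hca
        have : c ≠ b := fun h => hb'.2 (h ▸ ha'.1)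
        simp [this, ha'.1]
      · by_cases hcb : c = b
        · subst hcb; simp [hb'.1]
        · simp [hca, hcb]
    rw [e, Finset.card_erase_of_mem ha, hk, Nat.add_sub_cancel]

theorem sum_loss_mul_loss (ρ Γ : Op n) (hΓ : ∀ g : matchgateGroup n, Commute (groupOp g)ᴴ Γ)
    (κ : ℕ) (g : matchgateGroup n) :
    ∑ s ∈ Finset.powersetCard κ (Finset.univ : Finset (Fin (2 * n))),
      loss ρ (basisOp s) (groupOp g) * loss ρ (Γ * basisOp s) (groupOp g) =
        (ρ * Γ * component κ ρ).trace := by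
  have h1 : (groupOp g * ρ * (groupOp g)ᴴ * (Γ * component κ (groupOp g * ρ * (groupOp g)ᴴ))).trace =
      (ρ * Γ * component κ ρ).trace := by
    rw [component_groupOp_conj, show groupOp g * ρ * (groupOp g)ᴴ *
        (Γ * (groupOp g * component κ ρ * (groupOp g)ᴴ)) =
        groupOp g * (ρ * ((groupOp g)ᴴ * Γ) * groupOp g * component κ ρ * (groupOp g)ᴴ) by
          simp only [mul_assoc],
      Matrix.trace_mul_comm, (hΓ g).eq]
    congr 1
    rw [mul_assoc, conjTranspose_groupOp_mul_self, mul_one, mul_assoc ρ, mul_assoc Γ,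
      conjTranspose_groupOp_mul_self, mul_one]
  rw [← h1, component, Finset.mul_sum, Finset.mul_sum, Matrix.trace_sum]
  refine Finset.sum_congr rfl fun s _ => ?_
  rw [mul_smul_comm, mul_smul_comm, Matrix.trace_smul, smul_eq_mul, loss, loss,
    Matrix.trace_mul_comm (basisOp s)]

/-- The second moment on a module `𝓑_κ` with `κ ≠ n`, twisted by an operator `Γ` that commutes
with the group. -/
theorem choose_mul_secondMoment (ρ : Op n) {Γ : Op n}
    (hΓ : ∀ g : matchgateGroup n, Commute (groupOp g)ᴴ Γ) {κ : ℕ} (hκ : κ ≠ n) {A B : Op n}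
    (hA : A ∈ majoranaModule n κ) (hB : B ∈ majoranaModule n κ) :
    ((2 * n).choose κ : ℂ) * secondMoment ρ A (Γ * B) =
      (A * B).trace * (ρ * Γ * component κ ρ).trace := by
  set S := Finset.powersetCard κ (Finset.univ : Finset (Fin (2 * n))) with hS
  have hcard : ∀ s ∈ S, s.card = κ := fun s hs => (Finset.mem_powersetCard.mp hs).2
  have hA' : A = ∑ s ∈ S, (basisOp s * A).trace • basisOp s := by
    have e := component_of_mem κ hA
    rw [if_pos rfl] at e
    exact e.symm
  have hB' : B = ∑ s ∈ S, (basisOp s * B).trace • basisOp s := by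
    have e := component_of_mem κ hB
    rw [if_pos rfl] at e
    exact e.symm
  have hsum : ∑ s ∈ S, secondMoment ρ (basisOp s) (Γ * basisOp s) =
      (ρ * Γ * component κ ρ).trace := by
    simp only [secondMoment_apply]
    rw [← integral_finsetSum _ fun s _ => integrable_loss_mul_loss ρ _ _]
    simp only [hS, sum_loss_mul_loss ρ Γ hΓ]
    simp
  have hdiag : ∀ s ∈ S, ((2 * n).choose κ : ℂ) * secondMoment ρ (basisOp s) (Γ * basisOp s) =
      (ρ * Γ * component κ ρ).trace := by
    intro s hs
    rw [← hsum, Finset.sum_congr rfl fun t ht => secondMoment_basisOp_eq ρ hΓ _ t s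
      ((hcard t ht).trans (hcard s hs).symm) rfl]
    simp [hS]
  have htr : (A * B).trace = ∑ s ∈ S, (basisOp s * A).trace * (basisOp s * B).trace := by
    conv_lhs => rw [hA']
    rw [Finset.sum_mul, Matrix.trace_sum]
    exact Finset.sum_congr rfl fun s _ => by
      rw [smul_mul_assoc, Matrix.trace_smul, smul_eq_mul]
  have hexp : secondMoment ρ A (Γ * B) = ∑ s ∈ S, (basisOp s * A).trace *
      ((basisOp s * B).trace * secondMoment ρ (basisOp s) (Γ * basisOp s)) := by
    conv_lhs => rw [hA', hB']
    rw [map_sum, LinearMap.sum_apply, Finset.mul_sum]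
    refine Finset.sum_congr rfl fun s hs => ?_
    rw [map_smul, LinearMap.smul_apply, smul_eq_mul, map_sum, Finset.sum_eq_single_of_mem s hs,
      mul_smul_comm, map_smul, smul_eq_mul]
    intro t ht hts
    rw [mul_smul_comm, map_smul, secondMoment_basisOp_eq_zero ρ hΓ hts.symm, smul_zero]
    rw [hcard s hs, hcard t ht]
    omega
  rw [hexp, htr, Finset.mul_sum, Finset.sum_mul]
  refine Finset.sum_congr rfl fun s hs => ?_
  rw [← hdiag s hs]
  ring

theorem secondMoment_eq_zero (ρ : Op n) {κ κ' : ℕ} (hne : κ ≠ κ') (h : κ + κ' ≠ 2 * n)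
    {A B : Op n} (hA : A ∈ majoranaModule n κ) (hB : B ∈ majoranaModule n κ') :
    secondMoment ρ A B = 0 := by
  have eA := component_of_mem κ hA
  have eB := component_of_mem κ' hB
  rw [if_pos rfl] at eA eB
  rw [← eA, ← eB, component, component, map_sum (secondMoment ρ), LinearMap.sum_apply]
  refine Finset.sum_eq_zero fun s hs => ?_
  rw [map_smul, LinearMap.smul_apply, map_sum, Finset.sum_eq_zero, smul_zero]
  intro t ht
  have hs' := (Finset.mem_powersetCard.mp hs).2
  have ht' := (Finset.mem_powersetCard.mp ht).2
  have := secondMoment_basisOp_eq_zero ρ (Γ := 1) (fun _ => .one_right _) (s := s) (t := t)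
    (fun e => hne (by rw [← hs', ← ht', e])) (by rw [hs', ht']; exact h)
  rw [one_mul] at this
  rw [map_smul, this, smul_zero]

end Matchgate

namespace Matchgate

open MeasureTheory

variable {n : ℕ}

section TensorPow

variable {ι : Type*} [Fintype ι]

theorem tensorPow_mul (t : ℕ) (A B : Matrix ι ι ℂ) :
    tensorPow t (A * B) = tensorPow t A * tensorPow t B := by
  classical
  ext x y
  simp only [tensorPow, Matrix.mul_apply, Matrix.of_apply, ← Finset.prod_mul_distrib]
  rw [Finset.prod_univ_sum, Fintype.piFinset_univ]

theorem trace_tensorPow (t : ℕ) (A : Matrix ι ι ℂ) :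
    (tensorPow t A).trace = A.trace ^ t := by
  classical
  simp only [tensorPow, Matrix.trace, Matrix.diag_apply, Matrix.of_apply]
  rw [Finset.sum_pow', Fintype.piFinset_univ]

end TensorPow

theorem loss_pow (ρ O U : Op n) (t : ℕ) :
    loss ρ O U ^ t = ∑ x, ∑ y, (tensorPow t U * tensorPow t ρ * tensorPow t Uᴴ) x y *
      tensorPow t O y x := by
  rw [loss, ← trace_tensorPow, tensorPow_mul, tensorPow_mul, tensorPow_mul]
  rfl

theorem continuous_tensorPow_conj (t : ℕ) (ρ : Op n) (x y : Fin t → Qubits n) :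
    Continuous fun u : Matrix.unitaryGroup (Qubits n) ℂ =>
      (tensorPow t (u : Op n) * tensorPow t ρ * tensorPow t (u : Op n)ᴴ) x y := by
  have h : ∀ i j : Qubits n, Continuous fun u : Matrix.unitaryGroup (Qubits n) ℂ =>
      ((u : Op n) * ρ * (u : Op n)ᴴ) i j := fun i j =>
    Continuous.matrix_elem (by fun_prop) i j
  simp only [← tensorPow_mul]
  exact continuous_finsetProd Finset.univ fun k _ => h (x k) (y k)

theorem integral_loss_pow {Θ : Type*} [TopologicalSpace Θ] [MeasurableSpace Θ]
    [OpensMeasurableSpace Θ] (μ : Measure Θ) [IsFiniteMeasure μ]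
    {U : Θ → Matrix.unitaryGroup (Qubits n) ℂ} (hU : Continuous U) (ρ O : Op n) (t : ℕ) :
    ∫ θ, loss ρ O (U θ) ^ t ∂μ = ∑ x, ∑ y,
      (∫ θ, (tensorPow t (U θ : Op n) * tensorPow t ρ * tensorPow t (U θ : Op n)ᴴ) x y ∂μ) *
        tensorPow t O y x := by
  have hint : ∀ x y, Integrable (fun θ =>
      (tensorPow t (U θ : Op n) * tensorPow t ρ * tensorPow t (U θ : Op n)ᴴ) x y *
        tensorPow t O y x) μ := fun x y =>
    (integrable_comp_unitary μ hU (continuous_tensorPow_conj t ρ x y)).mul_const _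
  simp only [loss_pow]
  rw [integral_finsetSum _ fun x _ => integrable_finsetSum _ fun y _ => hint x y]
  refine Finset.sum_congr rfl fun x _ => ?_
  rw [integral_finsetSum _ fun y _ => hint x y]
  exact Finset.sum_congr rfl fun y _ => integral_mul_const _ _

theorem exp_generator {H : Op n} (hH : H ∈ generators n) (t : ℝ) :
    ∃ a b : Fin (2 * n), a ≠ b ∧ NormedSpace.exp ((-Complex.I * (t : ℂ)) • H) =
      Real.cos t • 1 - Real.sin t • (majorana a * majorana b : Op n) := by
  obtain ⟨a, b, hab, e⟩ := generator_eq hH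
  refine ⟨a, b, hab, ?_⟩
  have h1 : (-Complex.I * (t : ℂ)) • H = (-t) • (majorana a * majorana b : Op n) := by
    rw [← e, ← Complex.coe_smul, smul_smul]
    congr 1
    push_cast
    ring
  rw [h1, exp_smul_of_mul_self (pair_mul_self hab), Real.cos_neg, Real.sin_neg, neg_smul,
    sub_eq_add_neg]

theorem exp_generator_mem_unitaryGroup {H : Op n} (hH : H ∈ generators n) (t : ℝ) :
    NormedSpace.exp ((-Complex.I * (t : ℂ)) • H) ∈ Matrix.unitaryGroup (Qubits n) ℂ := by
  obtain ⟨a, b, hab, e⟩ := exp_generator hH t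
  have h : (Real.cos t * Real.cos t + Real.sin t * Real.sin t : ℝ) = 1 := by
    have := Real.cos_sq_add_sin_sq t
    nlinarith
  rw [e, Matrix.mem_unitaryGroup_iff, Matrix.star_eq_conjTranspose, Matrix.conjTranspose_sub,
    Matrix.conjTranspose_smul, Matrix.conjTranspose_smul, Matrix.conjTranspose_one,
    pair_conjTranspose hab, star_trivial, star_trivial, smul_neg, sub_neg_eq_add, sub_mul, mul_add,
    mul_add, smul_mul_smul_comm, smul_mul_smul_comm, smul_mul_smul_comm, smul_mul_smul_comm,
    pair_mul_self hab, mul_one, one_mul, mul_one, mul_comm (Real.sin t) (Real.cos t), smul_neg]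
  have h1 : (1 : Op n) = (Real.cos t * Real.cos t) • 1 + (Real.sin t * Real.sin t) • 1 := by
    rw [← add_smul, h, one_smul]
  conv_rhs => rw [h1]
  abel

theorem continuous_exp_generator {H : Op n} (hH : H ∈ generators n) :
    Continuous fun t : ℝ => NormedSpace.exp ((-Complex.I * (t : ℂ)) • H) := by
  obtain ⟨a, b, hab, e⟩ := generator_eq hH
  have h1 : ∀ t : ℝ, NormedSpace.exp ((-Complex.I * (t : ℂ)) • H) =
      Real.cos (-t) • 1 + Real.sin (-t) • (majorana a * majorana b : Op n) := by
    intro t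
    rw [← exp_smul_of_mul_self (pair_mul_self hab), ← e, ← Complex.coe_smul, smul_smul]
    congr 2
    push_cast
    ring
  simp only [h1]
  fun_prop

theorem circuit_mem_unitaryGroup {L : ℕ} {H : Fin L → Op n} (hH : ∀ l, H l ∈ generators n)
    (θ : Fin L → ℝ) : circuit H θ ∈ Matrix.unitaryGroup (Qubits n) ℂ := by
  refine Submonoid.list_prod_mem _ fun A hA => ?_
  obtain ⟨l, rfl⟩ := (List.mem_ofFn' _ _).mp hA
  exact exp_generator_mem_unitaryGroup (hH l) _

theorem continuous_circuit {L : ℕ} {H : Fin L → Op n} (hH : ∀ l, H l ∈ generators n) :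
    Continuous (circuit H) := by
  unfold circuit
  simp only [List.ofFn_eq_map]
  exact continuous_list_prod _ fun l _ =>
    (continuous_exp_generator (hH l)).comp (continuous_apply l)

theorem integral_loss_pow_circuit {L : ℕ} {H : Fin L → Op n} (hH : ∀ l, H l ∈ generators n)
    (μ : Measure (Fin L → ℝ)) [IsProbabilityMeasure μ] (hU : IsTwoDesign μ (circuit H))
    (ρ O : Op n) {t : ℕ} (ht : t ≤ 2) :
    ∫ θ, loss ρ O (circuit H θ) ^ t ∂μ = ∫ g, loss ρ O (groupOp g) ^ t ∂(haar n) := by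
  have h1 := integral_loss_pow μ
    (U := fun θ => ⟨circuit H θ, circuit_mem_unitaryGroup hH θ⟩)
    (by exact (continuous_circuit hH).subtype_mk _) ρ O t
  have h2 := integral_loss_pow (haar n) (U := fun g : matchgateGroup n => g.1)
    continuous_subtype_val ρ O t
  rw [h1, h2]
  refine Finset.sum_congr rfl fun x _ => Finset.sum_congr rfl fun y _ => ?_
  rw [hU t ht (tensorPow t ρ) x y]

theorem lossVariance_eq {L : ℕ} {H : Fin L → Op n} (hH : ∀ l, H l ∈ generators n)
    (μ : Measure (Fin L → ℝ)) [IsProbabilityMeasure μ] (hU : IsTwoDesign μ (circuit H))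
    (ρ O : Op n) :
    lossVariance μ ρ O (circuit H) = secondMoment ρ O O - firstMoment ρ O ^ 2 := by
  have h1 := integral_loss_pow_circuit hH μ hU ρ O one_le_two
  have h2 := integral_loss_pow_circuit hH μ hU ρ O le_rfl
  simp only [pow_one] at h1
  rw [lossVariance, h1, h2, secondMoment_apply, firstMoment_apply]
  simp only [sq]

theorem purity_eq {κ : ℕ} {M : Op n} (hM : M.IsHermitian) :
    purity κ M = (component κ M * component κ M).trace := by
  rw [purity, form, one_mul, component_isHermitian κ hM]

theorem purity_eq_trace_mul {κ : ℕ} {M : Op n} (hM : M.IsHermitian) :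
    purity κ M = (M * 1 * component κ M).trace := by
  rw [purity_eq hM, trace_component_mul_of_mem (component_mem κ M), mul_one, Matrix.trace_mul_comm]

theorem coherence_eq {κ κ' : ℕ} (h : κ + κ' = 2 * n) {M : Op n} (hM : M.IsHermitian) :
    coherence κ M =
      Complex.I ^ (κ % 2) * (parity n * component κ M * component κ' M).trace := by
  rw [coherence, form, component_isHermitian κ hM, show 2 * n - κ = κ' by omega]

theorem coherence_eq_trace_mul {κ κ' : ℕ} (h : κ + κ' = 2 * n) {M : Op n} (hM : M.IsHermitian) :
    coherence κ M = Complex.I ^ (κ % 2) * (M * parity n * component κ M).trace := by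
  have hmem : parity n * component κ M ∈ majoranaModule n κ' := by
    rw [show κ' = 2 * n - κ by omega]
    exact parity_mul_mem (component_mem κ M)
  rw [coherence_eq h hM, trace_component_mul_of_mem hmem, Matrix.trace_mul_comm, mul_assoc]

theorem choose_mul_secondMoment_self {ρ : Op n} (hρ : ρ.IsHermitian) {κ : ℕ} (hκ : κ ≠ n)
    {A : Op n} (hA : A ∈ majoranaModule n κ) :
    ((2 * n).choose κ : ℂ) * secondMoment ρ A A = purity κ ρ * (A * A).trace := by
  have h := choose_mul_secondMoment ρ (Γ := 1) (fun _ => .one_right _) hκ hA hA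
  rwa [one_mul, ← purity_eq_trace_mul hρ, mul_comm (A * A).trace] at h

theorem choose_mul_secondMoment_dual {ρ : Op n} (hρ : ρ.IsHermitian) {κ κ' : ℕ} (hκ : κ ≠ n)
    (h : κ + κ' = 2 * n) {A B : Op n} (hA : A ∈ majoranaModule n κ)
    (hB : B ∈ majoranaModule n κ') :
    ((2 * n).choose κ : ℂ) * secondMoment ρ A B =
      coherence κ ρ * (Complex.I ^ (κ % 2) * (parity n * A * B).trace) := by
  have hcomm : ∀ g : matchgateGroup n, Commute (groupOp g)ᴴ (parity n) := by
    intro g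
    have := congrArg Matrix.conjTranspose (groupOp_mul_parity g)
    rw [Matrix.conjTranspose_mul, Matrix.conjTranspose_mul, parity, tensor_conjTranspose,
      pauliZ_conjTranspose] at this
    exact this.symm
  have hPB : parity n * B ∈ majoranaModule n κ := by
    rw [show κ = 2 * n - κ' by omega]
    exact parity_mul_mem hB
  have h1 := choose_mul_secondMoment ρ hcomm hκ hA hPB
  rw [← mul_assoc, parity_mul_self, one_mul] at h1
  rw [h1, coherence_eq_trace_mul h hρ, parity_mul_eq hA, smul_mul_assoc, Matrix.trace_smul,
    mul_assoc A, smul_eq_mul]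
  have hI : Complex.I ^ (κ % 2) * Complex.I ^ (κ % 2) * (-1) ^ κ = 1 := by
    rcases Nat.even_or_odd κ with he | ho
    · rw [Nat.even_iff.mp he, he.neg_one_pow]; simp
    · rw [Nat.odd_iff.mp ho, ho.neg_one_pow]; simp
  linear_combination (-(A * (parity n * B)).trace * (ρ * parity n * component κ ρ).trace) * hI

end Matchgate

end

theorem corollary2 {n L : ℕ}
    -- the generators of the circuit and the distribution of its parameters
    (H : Fin L → Matchgate.Op n) (hH : ∀ l, H l ∈ Matchgate.generators n)
    (μ : MeasureTheory.Measure (Fin L → ℝ)) [MeasureTheory.IsProbabilityMeasure μ]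
    -- the circuit forms a 2-design over the group
    (hU : Matchgate.IsTwoDesign μ (Matchgate.circuit H))
    -- the state and the observable
    (ρ O : Matchgate.Op n) (hρ : ρ.PosSemidef) (hρ_trace : ρ.trace = 1) (hO : O.IsHermitian)
    -- two different modules other than the module `n` and the two trivial ones
    (κ κ' : ℕ) (hκ : 0 < κ ∧ κ < 2 * n) (hκ' : 0 < κ' ∧ κ' < 2 * n)
    (hne : κ ≠ κ') (hκn : κ ≠ n) (hκn' : κ' ≠ n)
    (hOmem : O ∈ Matchgate.majoranaModule n κ ⊔ Matchgate.majoranaModule n κ') :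
    Module.finrank ℂ (Matchgate.majoranaModule n κ) = (2 * n).choose κ ∧
    Module.finrank ℂ (Matchgate.majoranaModule n κ') = (2 * n).choose κ' ∧
    Matchgate.lossVariance μ ρ O (Matchgate.circuit H) =
      Matchgate.purity κ ρ * Matchgate.purity κ O /
          (Module.finrank ℂ (Matchgate.majoranaModule n κ) : ℂ) +
        Matchgate.purity κ' ρ * Matchgate.purity κ' O /
          (Module.finrank ℂ (Matchgate.majoranaModule n κ') : ℂ) +
        2 * (if κ + κ' = 2 * n then 1 else 0) *
          (Matchgate.coherence κ ρ * Matchgate.coherence κ O /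
            (Module.finrank ℂ (Matchgate.majoranaModule n κ) : ℂ)) := by
  open Matchgate in
  refine ⟨finrank_majoranaModule κ, finrank_majoranaModule κ', ?_⟩
  obtain ⟨A, hA, B, hB, hAB⟩ := Submodule.mem_sup.mp hOmem
  have hOA : component κ O = A := by
    rw [← hAB, component_add, component_of_mem κ hA, component_of_mem κ hB, if_pos rfl,
      if_neg hne.symm, add_zero]
  have hOB : component κ' O = B := by
    rw [← hAB, component_add, component_of_mem κ' hA, component_of_mem κ' hB, if_pos rfl,
      if_neg hne, zero_add]
  have hmean : firstMoment ρ O = 0 := by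
    rw [← hAB, map_add, firstMoment_eq_zero ρ hκ.1 hκ.2 hA, firstMoment_eq_zero ρ hκ'.1 hκ'.2 hB,
      add_zero]
  have hvar : secondMoment ρ O O =
      secondMoment ρ A A + secondMoment ρ B B + 2 * secondMoment ρ A B := by
    rw [← hAB, LinearMap.map_add₂, map_add, map_add,
      secondMoment_comm ρ B A]
    ring
  have hc : ((2 * n).choose κ : ℂ) ≠ 0 :=
    Nat.cast_ne_zero.mpr (Nat.choose_pos hκ.2.le).ne'
  have hc' : ((2 * n).choose κ' : ℂ) ≠ 0 :=
    Nat.cast_ne_zero.mpr (Nat.choose_pos hκ'.2.le).ne'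
  have hAA := choose_mul_secondMoment_self hρ.isHermitian hκn hA
  have hBB := choose_mul_secondMoment_self hρ.isHermitian hκn' hB
  rw [lossVariance_eq hH μ hU, hmean, hvar, finrank_majoranaModule, finrank_majoranaModule,
    purity_eq hO, purity_eq hO, hOA, hOB, ← hAA, ← hBB, mul_div_cancel_left₀ _ hc,
    mul_div_cancel_left₀ _ hc']
  by_cases hd : κ + κ' = 2 * n
  · have hX := choose_mul_secondMoment_dual hρ.isHermitian hκn hd hA hB
    rw [if_pos hd, coherence_eq hd hO, hOA, hOB, ← hX, mul_div_cancel_left₀ _ hc]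
    ring
  · rw [if_neg hd, secondMoment_eq_zero ρ hne hd hA hB]
    ring
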